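/- **Setting.** A bandit has arms $a\in\{1,\dots,n\}$, a finite mediator set $\mathcal M$ with $|\mathcal M|=K$ and a finite set of real outcomes $\mathcal Y$ with $|\mathcal Y|=L$, normalized so that $\sum_{y\in\mathcal Y}|y|=1$. Each pull of arm $a$ draws, independently of the past, a triple $(M,Y,O)\in\mathcal M\times\mathcal Y\times\{0,1\}$ from a fixed law $\mathbb P(\cdot\mid a)$; the agent sees $M$ and $O$, and it sees $Y$ if and only if $O=1$. Write $p_{y,a}=\mathbb P(Y=y\mid a)$, $\gamma_{y,a}=\mathbb P(O=1\mid Y=y,a)$, $\gamma_a=\min_{y:\,p_{y,a}>0}\gamma_{y,a}$, $\Theta_a=[\mathbb P(M=m,Y=y,O=1\mid a)]_{m,y}\in\mathbb R^{K\times L}$ and $\mu_a=\mathbb E[Y\mid a]$. The cumulative regret is $R_T=\sum_{t=1}^T(\max_a\mu_a-\mu_{a_t})$, where $a_t$ is the arm pulled in round $t$. Let $\|\cdot\|_\infty$ be the matrix norm induced by the $\infty$-norm, $\Theta^\dagger$ the Moore–Penrose pseudo-inverse, and $\kappa(\Theta)=\|\Theta\|_\infty\|\Theta^\dagger\|_\infty$.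 **Assumptions.** For every arm $a$: (MNAR) $O$ and $M$ are conditionally independent given $Y$; (completeness) if $g:\mathcal Y\to\mathbb R$ satisfies $\sum_y\mathbb P(M=m,Y=y,O=1\mid a)\,g(y)=0$ for all $m$, then $g(Y)=0$ with probability one under $\mathbb P(\cdot\mid a)$; (condition number) $\kappa(\Theta_a)\le C_a$. **Algorithm** (inputs $n$, $\mathcal M$, $\mathcal Y$, the horizon $T$, $\alpha$, and the bounds $C_a$). First pull each arm $\lceil\log(T)^2\rceil$ times, one arm after the other. In every later round let, for each arm $a$, $T_a$ be the number of its pulls so far and $T_{a,o}$ the number of those with $O=1$; let $\hat\theta_a[m,y]$ be the fraction of its pulls with $(M,Y,O)=(m,y,1)$ and $\hat b_a[m]$ the fraction with $(M,O)=(m,0)$. Put $$\hat x_a=\hat\theta_a^{\dagger}\hat b_a+\mathbf 1,\qquad \hat p_a(m,y)=\hat x_a[y]\,\hat\theta_a[m,y],\qquad \hat\mu_a=\sum_y y\sum_m\hat p_a(m,y),\qquad \hat\gamma_a=\frac1{\max_y\hat x_a[y]},$$ $$\mathrm{UCB}_a=\hat\mu_a+8\,\frac{L\,C_a}{\|\hat\theta_a\|_\infty\,\hat\gamma_a}\sqrt{\frac{\alpha\log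 T}{T_a}}+\frac{K}{\hat\gamma_a}\sqrt{\frac{\alpha\log T}{T_{a,o}}},$$ and pull an arm that maximizes $\mathrm{UCB}_a$ (ties are broken in any way). **Theorem.** There is a universal constant $c>0$ such that for every $\alpha>1$ there is a threshold $T_0$, depending only on $\alpha$, $n$, $K$, $L$ and the numbers $C_a$, $\|\Theta_a\|_\infty$, $\gamma_a$, such that under the above assumptions, for all $T\ge T_0$, $$\mathbb E[R_T]\le c\,\sqrt{\alpha\,T\log(T)\sum_a S_a^2},\qquad S_a=\max\left\{\frac{L\,C_a}{\gamma_a\|\Theta_a\|_\infty},\ \frac{K}{\gamma_a\sqrt{\sum_{y}p_{y,a}\gamma_{y,a}}}\right\}.$$ -/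

import Mathlib

open MeasureTheory Finset Matrix

noncomputable section

namespace MNARBandit

/-! ### Matrices: the `∞`-norm, the Moore-Penrose inverse and the condition number -/

section InfNorm

attribute [local instance] Matrix.linftyOpNormedAddCommGroup

/-- The operator norm induced by the `∞`-norm, that is, the maximal absolute row sum. -/
def infNorm {K L : ℕ} (A : Matrix (Fin K) (Fin L) ℝ) : ℝ := ‖A‖

end InfNorm

/-- The four Penrose equations, which characterise the pseudo-inverse of a real matrix. -/
structure IsPseudoInverse {K L : ℕ} (A : Matrix (Fin K) (Fin L) ℝ)
    (B : Matrix (Fin L) (Fin K) ℝ) : Prop where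
  mul_mul_left : A * B * A = A
  mul_mul_right : B * A * B = B
  symm_left : (A * B)ᵀ = A * B
  symm_right : (B * A)ᵀ = B * A

/-- The Moore-Penrose inverse of `A`: if `Aᵀ * A = U * diag(d) * Uᵀ` is a spectral decomposition,
it is `U * diag(d⁻¹) * Uᵀ * Aᵀ`, where `0⁻¹ = 0`. -/
def pinv {K L : ℕ} (A : Matrix (Fin K) (Fin L) ℝ) : Matrix (Fin L) (Fin K) ℝ :=
  let hA : (Aᵀ * A).IsHermitian := Matrix.isHermitian_conjTranspose_mul_self A
  (hA.eigenvectorUnitary : Matrix (Fin L) (Fin L) ℝ) *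
    Matrix.diagonal (fun i => (hA.eigenvalues i)⁻¹) *
    (hA.eigenvectorUnitary : Matrix (Fin L) (Fin L) ℝ)ᵀ * Aᵀ

theorem isPseudoInverse_pinv {K L : ℕ} (A : Matrix (Fin K) (Fin L) ℝ) :
    IsPseudoInverse A (pinv A) := by
  have hA : (Aᵀ * A).IsHermitian := Matrix.isHermitian_conjTranspose_mul_self A
  obtain ⟨U, hU⟩ : ∃ U : Matrix (Fin L) (Fin L) ℝ,
      U = (hA.eigenvectorUnitary : Matrix (Fin L) (Fin L) ℝ) := ⟨_, rfl⟩
  obtain ⟨d, hd⟩ : ∃ d : Fin L → ℝ, d = hA.eigenvalues := ⟨_, rfl⟩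
  have hUU : Uᵀ * U = 1 := by
    have := Unitary.coe_star_mul_self hA.eigenvectorUnitary
    rw [hU]
    simpa [Matrix.star_eq_conjTranspose] using this
  have hH : Aᵀ * A = U * diagonal d * Uᵀ := by
    have := hA.spectral_theorem
    rw [Unitary.conjStarAlgAut_apply] at this
    rw [hU, hd]
    simpa [Matrix.star_eq_conjTranspose] using this
  obtain ⟨P, hP⟩ : ∃ P : Matrix (Fin L) (Fin L) ℝ,
      P = U * diagonal (fun i => (d i)⁻¹) * Uᵀ := ⟨_, rfl⟩
  have hB : pinv A = P * Aᵀ := by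
    rw [hP, hU, hd]; rfl
  have key : ∀ X Y : Matrix (Fin L) (Fin L) ℝ,
      (U * X * Uᵀ) * (U * Y * Uᵀ) = U * (X * Y) * Uᵀ := by
    intro X Y
    calc (U * X * Uᵀ) * (U * Y * Uᵀ) = U * X * (Uᵀ * U) * Y * Uᵀ := by
          simp only [Matrix.mul_assoc]
      _ = U * (X * Y) * Uᵀ := by rw [hUU]; simp only [Matrix.mul_one, Matrix.mul_assoc]
  have hPt : Pᵀ = P := by
    rw [hP]; simp [Matrix.transpose_mul, Matrix.mul_assoc]
  have hHt : (Aᵀ * A)ᵀ = Aᵀ * A := by simp [Matrix.transpose_mul]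
  have hHPH : (Aᵀ * A) * P * (Aᵀ * A) = Aᵀ * A := by
    rw [hH, hP, key, key]
    congr 2
    rw [diagonal_mul_diagonal, diagonal_mul_diagonal]
    congr 1; funext i
    exact mul_inv_mul_cancel (d i)
  have hPHP : P * (Aᵀ * A) * P = P := by
    rw [hH, hP, key, key]
    congr 2
    rw [diagonal_mul_diagonal, diagonal_mul_diagonal]
    congr 1; funext i
    by_cases h : d i = 0
    · simp [h]
    · field_simp
  have hcomm : P * (Aᵀ * A) = (Aᵀ * A) * P := by
    rw [hH, hP, key, key]
    congr 2
    rw [diagonal_mul_diagonal, diagonal_mul_diagonal]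
    congr 1; funext i
    exact mul_comm _ _
  have hAPH : A * (P * (Aᵀ * A)) = A := by
    rw [← sub_eq_zero]
    rw [← Matrix.conjTranspose_mul_self_eq_zero]
    have e : (A * (P * (Aᵀ * A)) - A)ᴴ = (Aᵀ * A) * P * Aᵀ - Aᵀ := by
      rw [Matrix.conjTranspose_eq_transpose_of_trivial, Matrix.transpose_sub,
        Matrix.transpose_mul, Matrix.transpose_mul, hHt, hPt]
    rw [e, Matrix.sub_mul, Matrix.mul_sub, Matrix.mul_sub]
    have e1 : (Aᵀ * A) * P * Aᵀ * (A * (P * (Aᵀ * A))) =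
        ((Aᵀ * A) * P * (Aᵀ * A)) * (P * (Aᵀ * A)) := by simp only [Matrix.mul_assoc]
    have e2 : (Aᵀ * A) * P * Aᵀ * A = (Aᵀ * A) * P * (Aᵀ * A) := by
      simp only [Matrix.mul_assoc]
    have e3 : Aᵀ * (A * (P * (Aᵀ * A))) = (Aᵀ * A) * (P * (Aᵀ * A)) := by
      simp only [Matrix.mul_assoc]
    rw [e1, e2, e3, hHPH]
    simp
  refine ⟨?_, ?_, ?_, ?_⟩
  · rw [hB]
    calc A * (P * Aᵀ) * A = A * (P * (Aᵀ * A)) := by simp only [Matrix.mul_assoc]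
      _ = A := hAPH
  · rw [hB]
    calc P * Aᵀ * A * (P * Aᵀ) = (P * (Aᵀ * A) * P) * Aᵀ := by simp only [Matrix.mul_assoc]
      _ = P * Aᵀ := by rw [hPHP]
  · rw [hB]; simp [Matrix.transpose_mul, hPt, Matrix.mul_assoc]
  · rw [hB, Matrix.mul_assoc, Matrix.transpose_mul, hHt, hPt, hcomm]

theorem IsPseudoInverse.unique {K L : ℕ} {A : Matrix (Fin K) (Fin L) ℝ}
    {B B' : Matrix (Fin L) (Fin K) ℝ} (h : IsPseudoInverse A B) (h' : IsPseudoInverse A B') :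
    B = B' := by
  have e1 : A * B = A * B' := by
    calc A * B = (A * B' * A) * B := by rw [h'.mul_mul_left]
      _ = (A * B')ᵀ * (A * B)ᵀ := by rw [h'.symm_left, h.symm_left]; simp only [Matrix.mul_assoc]
      _ = (A * B * A * B')ᵀ := by rw [← Matrix.transpose_mul]; simp only [Matrix.mul_assoc]
      _ = A * B' := by rw [h.mul_mul_left, h'.symm_left]
  have e2 : B * A = B' * A := by
    calc B * A = B * (A * B' * A) := by rw [h'.mul_mul_left]
      _ = (B * A)ᵀ * (B' * A)ᵀ := by rw [h'.symm_right, h.symm_right]; simp only [Matrix.mul_assoc]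
      _ = (B' * (A * B * A))ᵀ := by rw [← Matrix.transpose_mul]; simp only [Matrix.mul_assoc]
      _ = B' * A := by rw [h.mul_mul_left, h'.symm_right]
  calc B = B * A * B := h.mul_mul_right.symm
    _ = B' * (A * B) := by rw [e2, Matrix.mul_assoc]
    _ = B' * A * B' := by rw [e1, Matrix.mul_assoc]
    _ = B' := h'.mul_mul_right

/-- The condition number `‖A‖_∞ ‖A†‖_∞`. -/
def condNumber {K L : ℕ} (A : Matrix (Fin K) (Fin L) ℝ) : ℝ := infNorm A * infNorm (pinv A)

/-! ### The bandit environment -/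

/-- A bandit with `n` arms, `K` mediator values and `L` outcomes. The outcome with label `y` is the
number `value y`; `law a` is the joint law of `(M, Y, O)` when arm `a` is pulled, where
`O = true` means that the outcome is observed. -/
structure Env (n K L : ℕ) where
  value : Fin L → ℝ
  law : Fin n → PMF (Fin K × Fin L × Bool)

variable {n K L : ℕ}

/-- `P(M = m, Y = y, O = o | a)`. -/
def Env.prob (E : Env n K L) (a : Fin n) (m : Fin K) (y : Fin L) (o : Bool) : ℝ :=
  (E.law a (m, y, o)).toReal

/-- `P(M = m, Y = y | a)`. -/
def Env.probMY (E : Env n K L) (a : Fin n) (m : Fin K) (y : Fin L) : ℝ :=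
  ∑ o, E.prob a m y o

/-- `P(Y = y, O = o | a)`. -/
def Env.probYO (E : Env n K L) (a : Fin n) (y : Fin L) (o : Bool) : ℝ :=
  ∑ m, E.prob a m y o

/-- `p_{y,a} = P(Y = y | a)`. -/
def Env.probY (E : Env n K L) (a : Fin n) (y : Fin L) : ℝ :=
  ∑ m, ∑ o, E.prob a m y o

/-- `γ_{y,a} = P(O = 1 | Y = y, a)`. -/
def Env.obsProb (E : Env n K L) (a : Fin n) (y : Fin L) : ℝ :=
  E.probYO a y true / E.probY a y

/-- `γ_a`, the minimum of `γ_{y,a}` over the outcomes `y` that arm `a` can produce (for the others,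
the conditional probability `γ_{y,a}` is not defined). -/
def Env.gammaMin (E : Env n K L) (a : Fin n) : ℝ :=
  ⨅ y : {y : Fin L // 0 < E.probY a y}, E.obsProb a y

/-- The matrix `Θ_a = [P(M = m, Y = y, O = 1 | a)]`. -/
def Env.theta (E : Env n K L) (a : Fin n) : Matrix (Fin K) (Fin L) ℝ :=
  Matrix.of fun m y => E.prob a m y true

/-- `μ_a = E[Y | a]`. -/
def Env.mean (E : Env n K L) (a : Fin n) : ℝ := ∑ y, E.value y * E.probY a y

/-- `max_a μ_a`. -/
def Env.bestMean (E : Env n K L) : ℝ := ⨆ a, E.mean a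

/-- The outcomes are normalised: `∑_y |y| = 1`. -/
def Env.IsNormalized (E : Env n K L) : Prop := ∑ y, |E.value y| = 1

/-- Missing not at random: under every arm, `O` and `M` are conditionally independent given `Y`. -/
def Env.IsMNAR (E : Env n K L) : Prop :=
  ∀ a m y o, E.prob a m y o * E.probY a y = E.probMY a m y * E.probYO a y o

/-- Completeness in the mediator: if `∑_y P(M = m, Y = y, O = 1 | a) g(y) = 0` for all `m`, then
`g(Y) = 0` with probability one under arm `a`. -/
def Env.IsComplete (E : Env n K L) : Prop :=
  ∀ (a : Fin n) (g : Fin L → ℝ), (∀ m, ∑ y, E.prob a m y true * g y = 0) →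
    ∀ y, 0 < E.probY a y → g y = 0

/-- The complexity `S_a` of arm `a`, for the bounds `C_a` on the condition numbers. -/
def Env.complexity (E : Env n K L) (C : Fin n → ℝ) (a : Fin n) : ℝ :=
  max (L * C a / (E.gammaMin a * infNorm (E.theta a)))
    (K / (E.gammaMin a * Real.sqrt (∑ y, E.probY a y * E.obsProb a y)))

/-! ### The algorithm

Rounds are numbered from `0`. A sequence `A` of arms and a sequence `Z` of feedbacks are given;
the statistics at time `t` use the rounds `s < t` only. -/

/-- What the agent sees: the mediator, and the outcome if it is not missing. -/
abbrev Feedback (K L : ℕ) := Fin K × Option (Fin L)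

/-- The feedback that results from a sample `(M, Y, O)`. -/
def feedback (x : Fin K × Fin L × Bool) : Feedback K L :=
  (x.1, if x.2.2 then some x.2.1 else none)

/-- `T_a`, the number of pulls of arm `a`. -/
def pulls (A : ℕ → Fin n) (t : ℕ) (a : Fin n) : ℕ :=
  ((range t).filter fun s => A s = a).card

/-- `T_{a,o}`, the number of pulls of arm `a` with an observed outcome. -/
def obsPulls (A : ℕ → Fin n) (Z : ℕ → Feedback K L) (t : ℕ) (a : Fin n) : ℕ :=
  ((range t).filter fun s => A s = a ∧ (Z s).2 ≠ none).card

/-- The number of pulls of arm `a` with feedback `z`. -/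
def feedbackPulls (A : ℕ → Fin n) (Z : ℕ → Feedback K L) (t : ℕ) (a : Fin n)
    (z : Feedback K L) : ℕ :=
  ((range t).filter fun s => A s = a ∧ Z s = z).card

/-- The empirical version of `Θ_a`. -/
def thetaHat (A : ℕ → Fin n) (Z : ℕ → Feedback K L) (t : ℕ) (a : Fin n) :
    Matrix (Fin K) (Fin L) ℝ :=
  Matrix.of fun m y => (feedbackPulls A Z t a (m, some y) : ℝ) / pulls A t a

/-- The empirical version of the vector `b_a = [P(M = m, O = 0 | a)]`. -/
def bHat (A : ℕ → Fin n) (Z : ℕ → Feedback K L) (t : ℕ) (a : Fin n) : Fin K → ℝ :=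
  fun m => (feedbackPulls A Z t a (m, none) : ℝ) / pulls A t a

/-- The estimates `1 + OR_{y,a}` of `1 / γ_{y,a}`, where the estimated inverse odds ratios are the
pseudo-inverse solution of the empirical linear system. -/
def xHat (A : ℕ → Fin n) (Z : ℕ → Feedback K L) (t : ℕ) (a : Fin n) : Fin L → ℝ :=
  fun y => (pinv (thetaHat A Z t a) *ᵥ bHat A Z t a) y + 1

/-- The estimate of `P(M = m, Y = y | a) = (1 + OR_{y,a}) P(M = m, Y = y, O = 1 | a)`. -/
def pHat (A : ℕ → Fin n) (Z : ℕ → Feedback K L) (t : ℕ) (a : Fin n) (m : Fin K) (y : Fin L) : ℝ :=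
  xHat A Z t a y * thetaHat A Z t a m y

/-- The estimate of `μ_a`. -/
def muHat (value : Fin L → ℝ) (A : ℕ → Fin n) (Z : ℕ → Feedback K L) (t : ℕ) (a : Fin n) : ℝ :=
  ∑ y, value y * ∑ m, pHat A Z t a m y

/-- The estimate of `γ_a`. -/
def gammaHat (A : ℕ → Fin n) (Z : ℕ → Feedback K L) (t : ℕ) (a : Fin n) : ℝ :=
  1 / ⨆ y, xHat A Z t a y

/-- The upper confidence bound of arm `a` at time `t`, for horizon `T`. -/
def ucb (value : Fin L → ℝ) (C : Fin n → ℝ) (α : ℝ) (T : ℕ)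
    (A : ℕ → Fin n) (Z : ℕ → Feedback K L) (t : ℕ) (a : Fin n) : ℝ :=
  muHat value A Z t a
    + 8 * (L * C a / (infNorm (thetaHat A Z t a) * gammaHat A Z t a))
        * Real.sqrt (α * Real.log T / pulls A t a)
    + K / gammaHat A Z t a * Real.sqrt (α * Real.log T / obsPulls A Z t a)

/-- The number of initial pulls of each arm. -/
def exploreRounds (T : ℕ) : ℕ := ⌈Real.log T ^ 2⌉₊

/-- The processes `A` (arms) and `X` (samples `(M, Y, O)`) on the probability space `(Ω, P)` are a
run of the algorithm with horizon `T` in the environment `E`. Ties between maximal upper confidence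
bounds may be broken in any way. -/
structure IsRun (E : Env n K L) (C : Fin n → ℝ) (α : ℝ) (T : ℕ) {Ω : Type*} [MeasurableSpace Ω]
    (P : Measure Ω) (A : ℕ → Ω → Fin n) (X : ℕ → Ω → Fin K × Fin L × Bool) : Prop where
  measurable_arm : ∀ t, Measurable (A t)
  measurable_sample : ∀ t, Measurable (X t)
  /-- Given the past and the current arm `a`, the current sample has law `E.law a`. -/
  sample : ∀ t < T, ∀ (u : ℕ → Fin n) (v : ℕ → Fin K × Fin L × Bool)
    (x : Fin K × Fin L × Bool),
    P {ω | (∀ s ≤ t, A s ω = u s) ∧ (∀ s < t, X s ω = v s) ∧ X t ω = x} =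
      P {ω | (∀ s ≤ t, A s ω = u s) ∧ (∀ s < t, X s ω = v s)} * E.law (u t) x
  /-- At first, the arms are pulled in order, each of them `exploreRounds T` times. -/
  explore : ∀ t < T, t < n * exploreRounds T → ∀ ω, (A t ω : ℕ) = t / exploreRounds T
  /-- Then, an arm with maximal upper confidence bound is pulled. -/
  greedy : ∀ t < T, n * exploreRounds T ≤ t → ∀ ω, ∀ a,
    ucb E.value C α T (fun s => A s ω) (fun s => feedback (X s ω)) t a ≤
      ucb E.value C α T (fun s => A s ω) (fun s => feedback (X s ω)) t (A t ω)

/-- The cumulative regret over the rounds `t < T`. -/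
def regret (E : Env n K L) (T : ℕ) {Ω : Type*} (A : ℕ → Ω → Fin n) (ω : Ω) : ℝ :=
  ∑ t ∈ range T, (E.bestMean - E.mean (A t ω))

end MNARBandit

end

/-!
The proof has a probabilistic, a linear algebraic and a bandit part.

*Concentration.* Multiplying factors `φ (A s) (X s)` whose mean is at most one under every arm gives
a supermartingale (`IsRun.lintegral_prod_le_one`). With Hoeffding's lemma and Chernoff's bound, the
mean of a bounded function of the samples of one arm is, after `N` pulls, within `√(2 log T / N)`
times the width of its expectation, except with probability `2 * T ^ (-4)`. That leaves room for a
union bound over all times and all values of the random number `N`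
(`IsRun.measure_exists_deviation_le`), and the failure event costs a bounded amount of regret.

*Estimation.* Conditional independence makes the inverse odds ratios `1 / γ_{y,a} - 1` solve
`Θ_a x = b_a`, so the residual of the empirical system at the true solution is a centred sample mean,
of order `(1 / γ_a) √(log T / N)`. Completeness makes `Θ_a` injective on the vectors supported on
the possible outcomes. Impossible outcomes never occur, so the empirical matrix has the same zero
columns, and once it is close to `Θ_a` it has the same kernel and its pseudo-inverse has norm at
most `6 / 5 * C_a / ‖Θ_a‖` (`infNorm_pinv_le`). The error of `xHat` is this pseudo-inverse applied
to the residual (`IsAccurate.abs_xHat_sub_le`). The `log² T` exploratory pulls make every radius at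
most a multiple of `√(α / log T)`, so for large `T` the empirical norms, `gammaHat` and the share of
observed outcomes are within constant factors of their true values, and the upper confidence bound
exceeds the mean by at most `17 * S_a * √(α log T / N)` (`IsAccurate.ucb_bounds`).

*Regret.* Under optimism the gap of the pulled arm is at most that excess. Summing `1 / √N` over
the pulls of each arm and using the Cauchy-Schwarz inequality gives
`51 * √(α T log T ∑ S_a²)` (`IsRun.regret_le`); the exploration and the failure event add at most
`√T` each, which is a smaller term because `S_a ≥ 1`.
-/

namespace MNARBandit

/-! ### The `∞`-norm and perturbation of the pseudo-inverse -/

section Matrices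

attribute [local instance] Matrix.linftyOpNormedAddCommGroup

variable {K L J : ℕ}

theorem infNorm_nonneg (A : Matrix (Fin K) (Fin L) ℝ) : 0 ≤ infNorm A := norm_nonneg A

theorem infNorm_add_le (A B : Matrix (Fin K) (Fin L) ℝ) :
    infNorm (A + B) ≤ infNorm A + infNorm B := norm_add_le A B

theorem infNorm_sub_le (A B : Matrix (Fin K) (Fin L) ℝ) :
    infNorm (A - B) ≤ infNorm A + infNorm B := norm_sub_le A B

theorem infNorm_mul_le (A : Matrix (Fin K) (Fin L) ℝ) (B : Matrix (Fin L) (Fin J) ℝ) :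
    infNorm (A * B) ≤ infNorm A * infNorm B := linfty_opNorm_mul A B

theorem norm_mulVec_le (A : Matrix (Fin K) (Fin L) ℝ) (v : Fin L → ℝ) :
    ‖A *ᵥ v‖ ≤ infNorm A * ‖v‖ := linfty_opNorm_mulVec A v

theorem infNorm_le_of_row_sum_le {A : Matrix (Fin K) (Fin L) ℝ} {c : ℝ} (hc : 0 ≤ c)
    (h : ∀ i, ∑ j, |A i j| ≤ c) : infNorm A ≤ c := by
  change ‖A‖ ≤ c
  lift c to NNReal using hc
  rw [linfty_opNorm_def, NNReal.coe_le_coe]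
  refine Finset.sup_le fun i _ => ?_
  rw [← NNReal.coe_le_coe]
  simpa using h i

theorem row_sum_le_infNorm (A : Matrix (Fin K) (Fin L) ℝ) (i : Fin K) :
    ∑ j, |A i j| ≤ infNorm A := by
  change _ ≤ ‖A‖
  rw [linfty_opNorm_def]
  have := Finset.le_sup (f := fun i => ∑ j, ‖A i j‖₊) (mem_univ i)
  rw [← NNReal.coe_le_coe] at this
  simpa using this

theorem abs_entry_le_infNorm (A : Matrix (Fin K) (Fin L) ℝ) (i : Fin K) (j : Fin L) :
    |A i j| ≤ infNorm A :=
  (single_le_sum (f := fun j => |A i j|) (fun _ _ => abs_nonneg _) (mem_univ j)).trans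
    (row_sum_le_infNorm A i)

theorem infNorm_le_of_entry_le {A : Matrix (Fin K) (Fin L) ℝ} {c : ℝ} (hc : 0 ≤ c)
    (h : ∀ i j, |A i j| ≤ c) : infNorm A ≤ L * c := by
  refine infNorm_le_of_row_sum_le (by positivity) fun i => ?_
  calc ∑ j, |A i j| ≤ ∑ _j : Fin L, c := sum_le_sum fun j _ => h i j
    _ = L * c := by simp

theorem infNorm_transpose_le (A : Matrix (Fin K) (Fin L) ℝ) : infNorm Aᵀ ≤ K * infNorm A :=
  infNorm_le_of_entry_le (infNorm_nonneg A) fun i j => abs_entry_le_infNorm A j i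

/-- The entries of an orthogonal projection are at most one in absolute value, because
`P i i = ∑ j, P i j ^ 2`. -/
theorem infNorm_le_of_symm_idempotent {P : Matrix (Fin K) (Fin K) ℝ} (hs : Pᵀ = P)
    (hi : P * P = P) : infNorm P ≤ K := by
  have hsum : ∀ i, ∑ j, P i j ^ 2 = P i i := fun i => by
    conv_rhs => rw [← hi]
    rw [mul_apply]
    refine sum_congr rfl fun j _ => ?_
    have : P j i = P i j := congrFun (congrFun hs i) j
    rw [this, sq]
  have hle : ∀ i j, P i j ^ 2 ≤ P i i := fun i j => by
    rw [← hsum i]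
    exact single_le_sum (f := fun j => P i j ^ 2) (fun _ _ => sq_nonneg _) (mem_univ j)
  have hone : ∀ i, P i i ≤ 1 := fun i => by nlinarith [hle i i]
  have := infNorm_le_of_entry_le (A := P) zero_le_one fun i j =>
    (sq_le_one_iff_abs_le_one _).1 ((hle i j).trans (hone i))
  simpa using this

/-- If the columns of `A` outside `s` vanish and `A` is injective on the vectors supported in `s`,
then `A† A` is the coordinate projection onto `s`. -/
theorem pinv_mul_self_eq {A : Matrix (Fin K) (Fin L) ℝ} {s : Set (Fin L)}
    (h0 : ∀ i, ∀ j ∉ s, A i j = 0) (hinj : ∀ g, A *ᵥ g = 0 → ∀ j ∈ s, g j = 0) :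
    pinv A * A = diagonal (s.indicator 1) := by
  have hA := isPseudoInverse_pinv A
  ext i j
  by_cases hi : i ∈ s
  · have hz : A * (1 - pinv A * A) = 0 := by
      rw [Matrix.mul_sub, Matrix.mul_one, ← Matrix.mul_assoc, hA.mul_mul_left, sub_self]
    have := hinj (fun k => (1 - pinv A * A : Matrix (Fin L) (Fin L) ℝ) k j) (by
      ext k
      exact congrFun (congrFun hz k) j) i hi
    rw [Matrix.sub_apply, sub_eq_zero] at this
    rw [← this, diagonal_apply, one_apply, Set.indicator_of_mem hi, Pi.one_apply]
  · have h1 : (pinv A * A) i j = (pinv A * A) j i :=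
      (congrFun (congrFun hA.symm_right i) j).symm
    rw [h1, mul_apply, diagonal_apply, Set.indicator_of_notMem hi, ite_self]
    exact sum_eq_zero fun k _ => by rw [h0 k i hi, mul_zero]

theorem mul_diagonal_indicator {A : Matrix (Fin K) (Fin L) ℝ} {s : Set (Fin L)}
    (h0 : ∀ i, ∀ j ∉ s, A i j = 0) :
    A * (diagonal (s.indicator 1) : Matrix (Fin L) (Fin L) ℝ) = A := by
  ext i j
  rw [mul_diagonal]
  by_cases hj : j ∈ s
  · simp [hj]
  · simp [hj, h0 i j hj]

/-- Injectivity on the vectors supported in `s` survives a perturbation that is small compared to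
the norm of the pseudo-inverse. -/
theorem injOn_of_perturbation {A A' : Matrix (Fin K) (Fin L) ℝ} {s : Set (Fin L)}
    (h0 : ∀ i, ∀ j ∉ s, A i j = 0) (h0' : ∀ i, ∀ j ∉ s, A' i j = 0)
    (hinj : ∀ g, A *ᵥ g = 0 → ∀ j ∈ s, g j = 0)
    (hsmall : infNorm (pinv A) * infNorm (A' - A) < 1) :
    ∀ g, A' *ᵥ g = 0 → ∀ j ∈ s, g j = 0 := by
  intro g hg j hj
  set D : Matrix (Fin L) (Fin L) ℝ := diagonal (s.indicator 1) with hD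
  have hDD : D * D = D := by
    rw [hD, diagonal_mul_diagonal]
    congr 1
    funext k
    by_cases hk : k ∈ s <;> simp [hk]
  have hv : A' *ᵥ (D *ᵥ g) = 0 := by
    rw [mulVec_mulVec, mul_diagonal_indicator h0', hg]
  have hBA : pinv A * A' = D + pinv A * (A' - A) := by
    rw [Matrix.mul_sub, pinv_mul_self_eq h0 hinj]
    abel
  have hfix : D *ᵥ g = -((pinv A * (A' - A)) *ᵥ (D *ᵥ g)) := by
    have h1 : (pinv A * A') *ᵥ (D *ᵥ g) = 0 := by
      rw [← mulVec_mulVec, hv, mulVec_zero]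
    rw [hBA, add_mulVec, mulVec_mulVec, hDD] at h1
    exact eq_neg_of_add_eq_zero_left h1
  have hle : ‖D *ᵥ g‖ ≤ infNorm (pinv A) * infNorm (A' - A) * ‖D *ᵥ g‖ := by
    conv_lhs => rw [hfix]
    rw [norm_neg]
    exact (norm_mulVec_le _ _).trans
      (mul_le_mul_of_nonneg_right (infNorm_mul_le _ _) (norm_nonneg _))
  have hzero : ‖D *ᵥ g‖ = 0 := by
    by_contra hne
    have hpos : 0 < ‖D *ᵥ g‖ := lt_of_le_of_ne (norm_nonneg _) (Ne.symm hne)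
    nlinarith
  have := congrFun (norm_eq_zero.1 hzero) j
  rw [hD, mulVec_diagonal] at this
  simpa [hj] using this

/-- A quantitative continuity bound for the pseudo-inverse along perturbations that keep the kernel.
With `B = A†`, `B' = A'†` and `P' = A' B'` one has `B' = B P' - B (A' - A) B'`, and
`B P' - B = B ((1 - P') (A' - A) B)ᵀ`, while projections have norm at most `K`. -/
theorem infNorm_pinv_le_of_perturbation {A A' : Matrix (Fin K) (Fin L) ℝ} {s : Set (Fin L)}
    (h0 : ∀ i, ∀ j ∉ s, A i j = 0) (h0' : ∀ i, ∀ j ∉ s, A' i j = 0)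
    (hinj : ∀ g, A *ᵥ g = 0 → ∀ j ∈ s, g j = 0)
    (hsmall : infNorm (pinv A) * infNorm (A' - A) < 1) :
    infNorm (pinv A') ≤ infNorm (pinv A) + infNorm (pinv A) *
      (K * K * (infNorm (pinv A) * infNorm (A' - A))) +
      infNorm (pinv A) * infNorm (A' - A) * infNorm (pinv A') := by
  have hA := isPseudoInverse_pinv A
  have hA' := isPseudoInverse_pinv A'
  have hinj' := injOn_of_perturbation h0 h0' hinj hsmall
  have hBA := pinv_mul_self_eq h0 hinj
  have hBA' := pinv_mul_self_eq h0' hinj'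
  set B := pinv A
  set B' := pinv A'
  set Q : Matrix (Fin K) (Fin K) ℝ := 1 - A' * B' with hQ
  have hPP : A' * B' * (A' * B') = A' * B' := by
    rw [← Matrix.mul_assoc, hA'.mul_mul_left]
  have hQs : Qᵀ = Q := by
    rw [hQ, transpose_sub, transpose_one, hA'.symm_left]
  have hQi : Q * Q = Q := by
    rw [hQ, Matrix.sub_mul, Matrix.mul_sub, Matrix.mul_sub, hPP]
    simp
  have hQA : Q * A' = 0 := by
    rw [hQ, Matrix.sub_mul, Matrix.one_mul, hA'.mul_mul_left, sub_self]
  have hQAB : Q * (A * B) = -(Q * (A' - A) * B) := by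
    rw [Matrix.mul_sub, hQA, zero_sub, Matrix.neg_mul, neg_neg, Matrix.mul_assoc]
  have hABQ : A * B * Q = -(Q * (A' - A) * B)ᵀ := by
    rw [← transpose_neg, ← hQAB, transpose_mul, hQs, hA.symm_left]
  have hB' : B' = B * A * B' := by
    rw [hBA, ← hBA', hA'.mul_mul_right]
  have hBQ : B * Q = -(B * (Q * (A' - A) * B)ᵀ) := by
    calc B * Q = B * (A * B * Q) := by
          rw [← Matrix.mul_assoc, ← Matrix.mul_assoc, hA.mul_mul_right]
      _ = _ := by rw [hABQ, Matrix.mul_neg]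
  have hmain : B' = B + B * (Q * (A' - A) * B)ᵀ - B * (A' - A) * B' := by
    have h1 : B * (Q * (A' - A) * B)ᵀ = -(B * Q) := by rw [hBQ, neg_neg]
    rw [h1, hQ, Matrix.mul_sub, Matrix.mul_sub, Matrix.sub_mul, Matrix.mul_one, ← hB',
      Matrix.mul_assoc B A' B']
    abel
  have hb0 := infNorm_nonneg B
  have he0 := infNorm_nonneg (A' - A)
  have hT : infNorm (Q * (A' - A) * B)ᵀ ≤ K * (K * infNorm (A' - A) * infNorm B) := by
    refine (infNorm_transpose_le _).trans (mul_le_mul_of_nonneg_left ?_ (Nat.cast_nonneg _))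
    refine (infNorm_mul_le _ _).trans (mul_le_mul_of_nonneg_right ?_ hb0)
    exact (infNorm_mul_le _ _).trans
      (mul_le_mul_of_nonneg_right (infNorm_le_of_symm_idempotent hQs hQi) he0)
  calc infNorm B' = infNorm (B + B * (Q * (A' - A) * B)ᵀ - B * (A' - A) * B') := by
        rw [← hmain]
    _ ≤ infNorm B + infNorm (B * (Q * (A' - A) * B)ᵀ) + infNorm (B * (A' - A) * B') :=
        (infNorm_sub_le _ _).trans (by gcongr; exact infNorm_add_le _ _)
    _ ≤ infNorm B + infNorm B * (K * (K * infNorm (A' - A) * infNorm B)) +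
        infNorm B * infNorm (A' - A) * infNorm B' := by
        gcongr
        · exact (infNorm_mul_le _ _).trans (by gcongr)
        · exact (infNorm_mul_le _ _).trans
            (mul_le_mul_of_nonneg_right (infNorm_mul_le _ _) (infNorm_nonneg _))
    _ = _ := by ring

/-- Under a sufficiently small perturbation that keeps the kernel, the norm of the pseudo-inverse
grows by at most a fifth. -/
theorem infNorm_pinv_le {A A' : Matrix (Fin K) (Fin L) ℝ} {s : Set (Fin L)}
    (h0 : ∀ i, ∀ j ∉ s, A i j = 0) (h0' : ∀ i, ∀ j ∉ s, A' i j = 0)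
    (hinj : ∀ g, A *ᵥ g = 0 → ∀ j ∈ s, g j = 0)
    (hsmall : (K * K + 1) * (infNorm (pinv A) * infNorm (A' - A)) ≤ 1 / 20) :
    infNorm (pinv A') ≤ 6 / 5 * infNorm (pinv A) := by
  have hb0 := infNorm_nonneg (pinv A)
  have hb0' := infNorm_nonneg (pinv A')
  have he0 : 0 ≤ infNorm (pinv A) * infNorm (A' - A) :=
    mul_nonneg hb0 (infNorm_nonneg (A' - A))
  have hKK : (0 : ℝ) ≤ K * K := by positivity
  have h1 : infNorm (pinv A) * infNorm (A' - A) ≤ 1 / 20 := by nlinarith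
  have h2 : K * K * (infNorm (pinv A) * infNorm (A' - A)) ≤ 1 / 20 := by nlinarith
  have := infNorm_pinv_le_of_perturbation h0 h0' hinj (by linarith)
  nlinarith

end Matrices

/-! ### Concentration along a run -/

section Concentration

open scoped ENNReal

variable {n K L T : ℕ} {E : Env n K L} {C : Fin n → ℝ} {α : ℝ} {Ω : Type*} [MeasurableSpace Ω]
  {P : Measure Ω} {A : ℕ → Ω → Fin n} {X : ℕ → Ω → Fin K × Fin L × Bool}

/-- One step of a supermartingale: a factor depending on the current arm and sample, whose mean is
at most one under every arm, does not increase the integral of a function of the history. -/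
theorem IsRun.lintegral_mul_le (h : IsRun E C α T P A X) {t : ℕ} (ht : t < T) {F : Ω → ℝ≥0∞}
    (hF : ∀ ω ω', (∀ s ≤ t, A s ω = A s ω') → (∀ s < t, X s ω = X s ω') → F ω = F ω')
    {φ : Fin n → Fin K × Fin L × Bool → ℝ≥0∞} (hφ : ∀ a, ∑ x, E.law a x * φ a x ≤ 1) :
    ∫⁻ ω, F ω * φ (A t ω) (X t ω) ∂P ≤ ∫⁻ ω, F ω ∂P := by
  let H : Ω → (Fin (t + 1) → Fin n) × (Fin t → Fin K × Fin L × Bool) :=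
    fun ω => (fun s => A s ω, fun s => X s ω)
  have hH : Measurable H :=
    (measurable_pi_lambda _ fun s : Fin (t + 1) => h.measurable_arm s).prodMk
      (measurable_pi_lambda _ fun s : Fin t => h.measurable_sample s)
  have hHeq : ∀ ω ω', H ω = H ω' ↔ (∀ s ≤ t, A s ω = A s ω') ∧ ∀ s < t, X s ω = X s ω' := by
    intro ω ω'
    refine ⟨fun e => ⟨fun s hs => ?_, fun s hs => ?_⟩, fun e => Prod.ext (funext fun s => ?_)
      (funext fun s => ?_)⟩
    · exact congrFun (congrArg Prod.fst e) ⟨s, Nat.lt_succ_of_le hs⟩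
    · exact congrFun (congrArg Prod.snd e) ⟨s, hs⟩
    · exact e.1 s (Nat.le_of_lt_succ s.2)
    · exact e.2 s s.2
  have hfac : F.FactorsThrough H := fun ω ω' e => by
    obtain ⟨e1, e2⟩ := (hHeq ω ω').1 e
    exact hF ω ω' e1 e2
  set F' := Function.extend H F 0 with hF'
  have hFF : ∀ ω, F ω = F' (H ω) := fun ω => (hfac.extend_apply 0 ω).symm
  have hlaw : ∀ z x, P.map (fun ω => (H ω, X t ω)) {(z, x)} =
      P.map H {z} * E.law (z.1 (Fin.last t)) x := by
    intro z x
    rw [Measure.map_apply (hH.prodMk (h.measurable_sample t)) (measurableSet_singleton _),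
      Measure.map_apply hH (measurableSet_singleton _)]
    by_cases hz : ∃ ω₀, H ω₀ = z
    · obtain ⟨ω₀, rfl⟩ := hz
      have := h.sample t ht (fun s => A s ω₀) (fun s => X s ω₀) x
      have e1 : (fun ω => (H ω, X t ω)) ⁻¹' {(H ω₀, x)} = {ω | (∀ s ≤ t, A s ω = A s ω₀) ∧
          (∀ s < t, X s ω = X s ω₀) ∧ X t ω = x} := by
        ext ω
        simp only [Set.mem_preimage, Set.mem_singleton_iff, Prod.mk.injEq, hHeq,
          Set.mem_ofPred_eq, and_assoc]
      have e2 : H ⁻¹' {H ω₀} = {ω | (∀ s ≤ t, A s ω = A s ω₀) ∧ ∀ s < t, X s ω = X s ω₀} := by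
        ext ω
        simp only [Set.mem_preimage, Set.mem_singleton_iff, hHeq, Set.mem_ofPred_eq]
      rw [e1, e2]
      exact this
    · have h1 : H ⁻¹' {z} = ∅ := Set.eq_empty_of_forall_notMem fun ω hω => hz ⟨ω, hω⟩
      have h2 : (fun ω => (H ω, X t ω)) ⁻¹' {(z, x)} = ∅ :=
        Set.eq_empty_of_forall_notMem fun ω hω => hz ⟨ω, congrArg Prod.fst hω⟩
      rw [h1, h2]
      simp
  calc ∫⁻ ω, F ω * φ (A t ω) (X t ω) ∂P
      = ∫⁻ ω, (fun q => F' q.1 * φ (q.1.1 (Fin.last t)) q.2) (H ω, X t ω) ∂P :=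
        lintegral_congr fun ω => by rw [hFF]; rfl
    _ = ∫⁻ q, F' q.1 * φ (q.1.1 (Fin.last t)) q.2 ∂(P.map fun ω => (H ω, X t ω)) :=
        (lintegral_map (f := fun q : ((Fin (t + 1) → Fin n) × (Fin t → Fin K × Fin L × Bool)) ×
          Fin K × Fin L × Bool => F' q.1 * φ (q.1.1 (Fin.last t)) q.2) Measurable.of_discrete (hH.prodMk (h.measurable_sample t))).symm
    _ = ∑ z, ∑ x, F' z * φ (z.1 (Fin.last t)) x *
          (P.map H {z} * E.law (z.1 (Fin.last t)) x) := by
        rw [lintegral_fintype, Fintype.sum_prod_type]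
        simp only [hlaw]
    _ = ∑ z, F' z * P.map H {z} *
          ∑ x, E.law (z.1 (Fin.last t)) x * φ (z.1 (Fin.last t)) x := by
        refine sum_congr rfl fun z _ => ?_
        rw [mul_sum]
        exact sum_congr rfl fun x _ => by ring
    _ ≤ ∑ z, F' z * P.map H {z} :=
        sum_le_sum fun z _ => mul_le_of_le_one_right' (hφ _)
    _ = ∫⁻ ω, F ω ∂P := by
        rw [← lintegral_fintype, lintegral_map Measurable.of_discrete hH]
        exact lintegral_congr fun ω => (hFF ω).symm

theorem IsRun.lintegral_prod_le_one [IsProbabilityMeasure P] (h : IsRun E C α T P A X)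
    {φ : Fin n → Fin K × Fin L × Bool → ℝ≥0∞} (hφ : ∀ a, ∑ x, E.law a x * φ a x ≤ 1) :
    ∀ t ≤ T, ∫⁻ ω, ∏ s ∈ range t, φ (A s ω) (X s ω) ∂P ≤ 1 := by
  intro t
  induction t with
  | zero => simp
  | succ t ih =>
    intro ht
    simp only [prod_range_succ]
    refine (h.lintegral_mul_le (Nat.lt_of_succ_le ht) (fun ω ω' hA hX => ?_) hφ).trans
      (ih (Nat.le_of_succ_le ht))
    refine prod_congr rfl fun s hs => ?_
    rw [hA s (mem_range.1 hs).le, hX s (mem_range.1 hs)]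

theorem IsRun.measurable_prod (h : IsRun E C α T P A X)
    (φ : Fin n → Fin K × Fin L × Bool → ℝ≥0∞) (t : ℕ) :
    Measurable fun ω => ∏ s ∈ range t, φ (A s ω) (X s ω) :=
  Finset.measurable_prod _ fun s _ =>
    (Measurable.of_discrete (f := fun q : Fin n × (Fin K × Fin L × Bool) => φ q.1 q.2)).comp
      ((h.measurable_arm s).prodMk (h.measurable_sample s))

/-- Almost surely, only samples of positive probability occur. The product of the factors `⊤` for
impossible samples and `1` for the others has mean at most one, so it is finite. -/
theorem IsRun.ae_law_ne_zero [IsProbabilityMeasure P] (h : IsRun E C α T P A X) :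
    ∀ᵐ ω ∂P, ∀ s < T, E.law (A s ω) (X s ω) ≠ 0 := by
  classical
  let φ : Fin n → Fin K × Fin L × Bool → ℝ≥0∞ := fun a x => if E.law a x = 0 then ⊤ else 1
  have hφ : ∀ a, ∑ x, E.law a x * φ a x ≤ 1 := fun a => by
    have : ∀ x, E.law a x * φ a x = E.law a x := fun x => by
      by_cases hx : E.law a x = 0 <;> simp [φ, hx]
    simp only [this]
    rw [← tsum_fintype (L := .unconditional _), PMF.tsum_coe]
  have h1 := h.lintegral_prod_le_one hφ T le_rfl
  filter_upwards [ae_lt_top (h.measurable_prod φ T) (h1.trans_lt ENNReal.one_lt_top).ne]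
    with ω hω s hs h0
  have hge : ∀ s, 1 ≤ φ (A s ω) (X s ω) := fun s => by
    simp only [φ]
    split_ifs <;> simp
  have hle : φ (A s ω) (X s ω) ≤ ∏ s ∈ range T, φ (A s ω) (X s ω) :=
    single_le_prod' (fun i _ => hge i) (mem_range.2 hs)
  simp only [φ, h0, if_true] at hle
  exact absurd (hle.trans_lt hω) (by simp)

/-- The mean of `f (M, Y, O)` under arm `a`. -/
noncomputable def Env.expect (E : Env n K L) (a : Fin n) (f : Fin K × Fin L × Bool → ℝ) : ℝ :=
  ∑ x, (E.law a x).toReal * f x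

/-- The sum of `f (M, Y, O)` over the pulls of arm `a` before round `t`. -/
def armSum (A : ℕ → Fin n) (X : ℕ → Fin K × Fin L × Bool) (t : ℕ) (a : Fin n)
    (f : Fin K × Fin L × Bool → ℝ) : ℝ :=
  ∑ s ∈ range t with A s = a, f (X s)

theorem Env.sum_law (E : Env n K L) (a : Fin n) : ∑ x, (E.law a x).toReal = 1 := by
  rw [← ENNReal.toReal_sum fun x _ => (E.law a).apply_ne_top x,
    ← tsum_fintype (L := .unconditional _), PMF.tsum_coe, ENNReal.toReal_one]

/-- Hoeffding's lemma for the law of one arm. -/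
theorem Env.sum_law_mul_exp_le (E : Env n K L) (a : Fin n) {f : Fin K × Fin L × Bool → ℝ}
    {l w : ℝ} (hf : ∀ x, f x ∈ Set.Icc l (l + w)) (r : ℝ) :
    ∑ x, (E.law a x).toReal * Real.exp (r * (f x - E.expect a f)) ≤
      Real.exp (r ^ 2 * w ^ 2 / 8) := by
  have := (ProbabilityTheory.hasSubgaussianMGF_of_mem_Icc (μ := (E.law a).toMeasure)
    (X := f) (a := l) (b := l + w) Measurable.of_discrete.aemeasurable
    (Filter.Eventually.of_forall hf)).mgf_le r
  simp only [ProbabilityTheory.mgf, PMF.integral_eq_sum, smul_eq_mul] at this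
  refine this.trans (le_of_eq ?_)
  congr 1
  simp only [add_sub_cancel_left, NNReal.coe_pow, NNReal.coe_div, coe_nnnorm, Real.norm_eq_abs,
    NNReal.coe_ofNat, div_pow, sq_abs]
  ring

theorem Env.expect_neg (E : Env n K L) (a : Fin n) (f : Fin K × Fin L × Bool → ℝ) :
    E.expect a (fun x => -f x) = -E.expect a f := by
  simp [Env.expect]

theorem armSum_neg (A : ℕ → Fin n) (X : ℕ → Fin K × Fin L × Bool) (t : ℕ) (a : Fin n)
    (f : Fin K × Fin L × Bool → ℝ) : armSum A X t a (fun x => -f x) = -armSum A X t a f := by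
  simp [armSum]

/-- Chernoff's bound for the sum over `N` pulls of an arm, at a fixed time. -/
theorem IsRun.measure_armSum_gt_le [IsProbabilityMeasure P] (h : IsRun E C α T P A X) (a : Fin n)
    {f : Fin K × Fin L × Bool → ℝ} {l w : ℝ} (hw : 0 < w) (hf : ∀ x, f x ∈ Set.Icc l (l + w))
    {t N : ℕ} (ht : t ≤ T) (hN : 0 < N) {y : ℝ} (hy : 0 ≤ y) :
    P {ω | pulls (fun s => A s ω) t a = N ∧ w * Real.sqrt (2 * N * y) <
      armSum (fun s => A s ω) (fun s => X s ω) t a f - N * E.expect a f} ≤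
      ENNReal.ofReal (Real.exp (-(4 * y))) := by
  have hN' : (0 : ℝ) < N := Nat.cast_pos.2 hN
  -- the minimiser of the exponent in Chernoff's bound
  set r : ℝ := 4 * Real.sqrt (2 * N * y) / (N * w) with hr
  let φ : Fin n → Fin K × Fin L × Bool → ℝ≥0∞ := fun b x =>
    if b = a then ENNReal.ofReal (Real.exp (r * (f x - E.expect a f) - r ^ 2 * w ^ 2 / 8)) else 1
  have hφ : ∀ b, ∑ x, E.law b x * φ b x ≤ 1 := by
    intro b
    by_cases hb : b = a
    · subst hb
      have : ∀ x, E.law b x * φ b x = ENNReal.ofReal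
          ((E.law b x).toReal * Real.exp (r * (f x - E.expect b f)) *
            Real.exp (-(r ^ 2 * w ^ 2 / 8))) := fun x => by
        rw [mul_assoc, ← Real.exp_add, ENNReal.ofReal_mul ENNReal.toReal_nonneg,
          ENNReal.ofReal_toReal ((E.law b).apply_ne_top x)]
        simp only [φ, if_true]
        rw [← sub_eq_add_neg]
      simp only [this]
      rw [← ENNReal.ofReal_sum_of_nonneg (fun x _ => by positivity), ← sum_mul]
      refine ENNReal.ofReal_le_one.2 ?_
      rw [Real.exp_neg, ← div_eq_mul_inv, div_le_one (Real.exp_pos _)]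
      exact E.sum_law_mul_exp_le b hf r
    · simp only [φ, hb, if_false, mul_one]
      rw [← tsum_fintype (L := .unconditional _), PMF.tsum_coe]
  have hprod : ∀ ω, ∏ s ∈ range t, φ (A s ω) (X s ω) = ENNReal.ofReal (Real.exp
      (r * (armSum (fun s => A s ω) (fun s => X s ω) t a f -
        pulls (fun s => A s ω) t a * E.expect a f) -
        pulls (fun s => A s ω) t a * (r ^ 2 * w ^ 2 / 8))) := by
    intro ω
    simp only [φ, prod_ite, prod_const_one, mul_one]
    rw [← ENNReal.ofReal_prod_of_nonneg (fun _ _ => (Real.exp_pos _).le), ← Real.exp_sum]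
    congr 2
    rw [sum_sub_distrib, ← mul_sum, sum_sub_distrib]
    simp [armSum, pulls]
  have hsub : {ω | pulls (fun s => A s ω) t a = N ∧ w * Real.sqrt (2 * N * y) <
      armSum (fun s => A s ω) (fun s => X s ω) t a f - N * E.expect a f} ⊆
      {ω | ENNReal.ofReal (Real.exp (4 * y)) ≤ ∏ s ∈ range t, φ (A s ω) (X s ω)} := by
    rintro ω ⟨hp, hω⟩
    rw [Set.mem_ofPred_eq, hprod, hp]
    refine ENNReal.ofReal_le_ofReal (Real.exp_le_exp.2 ?_)
    have hq : Real.sqrt (2 * N * y) ^ 2 = 2 * N * y := Real.sq_sqrt (by positivity)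
    have h1 : r * (w * Real.sqrt (2 * N * y)) = 8 * y := by
      rw [hr]
      field_simp
      rw [hq]
      ring
    have h2 : N * (r ^ 2 * w ^ 2 / 8) = 4 * y := by
      have : ∀ q : ℝ, q ^ 2 = 2 * N * y → N * ((4 * q / (N * w)) ^ 2 * w ^ 2 / 8) = 4 * y := by
        intro q hq
        field_simp
        linarith
      exact this _ hq
    have h3 : r * (w * Real.sqrt (2 * N * y)) ≤ r *
        (armSum (fun s => A s ω) (fun s => X s ω) t a f - N * E.expect a f) :=
      mul_le_mul_of_nonneg_left hω.le (by positivity)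
    linarith
  refine (measure_mono hsub).trans ((meas_ge_le_lintegral_div
    (h.measurable_prod φ t).aemeasurable (by simp [Real.exp_pos]) ENNReal.ofReal_ne_top).trans ?_)
  rw [Real.exp_neg, ENNReal.ofReal_inv_of_pos (Real.exp_pos _), ← one_div]
  exact ENNReal.div_le_div_right (h.lintegral_prod_le_one hφ t ht) _

end Concentration

section UnionBound

open scoped ENNReal

variable {n K L T : ℕ} {E : Env n K L} {C : Fin n → ℝ} {α : ℝ} {Ω : Type*} [MeasurableSpace Ω]
  {P : Measure Ω} {A : ℕ → Ω → Fin n} {X : ℕ → Ω → Fin K × Fin L × Bool}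

theorem IsRun.measure_abs_armSum_gt_le [IsProbabilityMeasure P] (h : IsRun E C α T P A X)
    (a : Fin n) {f : Fin K × Fin L × Bool → ℝ} {l w : ℝ} (hw : 0 < w)
    (hf : ∀ x, f x ∈ Set.Icc l (l + w)) {t N : ℕ} (ht : t ≤ T) (hN : 0 < N) {y : ℝ} (hy : 0 ≤ y) :
    P {ω | pulls (fun s => A s ω) t a = N ∧ w * Real.sqrt (2 * N * y) <
      |armSum (fun s => A s ω) (fun s => X s ω) t a f - N * E.expect a f|} ≤
      ENNReal.ofReal (2 * Real.exp (-(4 * y))) := by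
  have h1 := h.measure_armSum_gt_le a hw hf ht hN hy
  have h2 := h.measure_armSum_gt_le a (f := fun x => -f x) (l := -(l + w)) hw
    (fun x => ⟨neg_le_neg (hf x).2, by linarith [(hf x).1]⟩) ht hN hy
  rw [two_mul (Real.exp _), ENNReal.ofReal_add (Real.exp_pos _).le (Real.exp_pos _).le]
  refine (measure_mono ?_).trans ((measure_union_le _ _).trans (add_le_add h1 h2))
  rintro ω ⟨hp, hω⟩
  rcases lt_abs.1 hω with hω | hω
  · exact Or.inl ⟨hp, hω⟩
  · refine Or.inr ⟨hp, ?_⟩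
    rw [armSum_neg, Env.expect_neg]
    linarith

/-- Uniform concentration of finitely many sample means. The number of pulls is random, so the union
is over all times and all possible numbers of pulls. -/
theorem IsRun.measure_exists_deviation_le [IsProbabilityMeasure P] (h : IsRun E C α T P A X)
    {ι : Type*} [Fintype ι] (f : Fin n → ι → Fin K × Fin L × Bool → ℝ) (l w : Fin n → ι → ℝ)
    (hw : ∀ a i, 0 < w a i) (hf : ∀ a i x, f a i x ∈ Set.Icc (l a i) (l a i + w a i))
    (hT : 1 ≤ T) :
    P {ω | ∃ a i, ∃ t ≤ T, w a i * Real.sqrt (2 * pulls (fun s => A s ω) t a * Real.log T) <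
      |armSum (fun s => A s ω) (fun s => X s ω) t a (f a i) -
        pulls (fun s => A s ω) t a * E.expect a (f a i)|} ≤
      ENNReal.ofReal (4 * (n * Fintype.card ι) / T ^ 2) := by
  have hT' : (1 : ℝ) ≤ T := by exact_mod_cast hT
  let I : Finset ((Fin n × ι) × ℕ × ℕ) := univ ×ˢ (range (T + 1) ×ˢ Icc 1 T)
  let S : (Fin n × ι) × ℕ × ℕ → Set Ω := fun q =>
    {ω | pulls (fun s => A s ω) q.2.1 q.1.1 = q.2.2 ∧
      w q.1.1 q.1.2 * Real.sqrt (2 * q.2.2 * Real.log T) <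
      |armSum (fun s => A s ω) (fun s => X s ω) q.2.1 q.1.1 (f q.1.1 q.1.2) -
        q.2.2 * E.expect q.1.1 (f q.1.1 q.1.2)|}
  have hsub : {ω | ∃ a i, ∃ t ≤ T,
      w a i * Real.sqrt (2 * pulls (fun s => A s ω) t a * Real.log T) <
      |armSum (fun s => A s ω) (fun s => X s ω) t a (f a i) -
        pulls (fun s => A s ω) t a * E.expect a (f a i)|} ⊆ ⋃ q ∈ I, S q := by
    rintro ω ⟨a, i, t, ht, hω⟩
    have hle : pulls (fun s => A s ω) t a ≤ T :=
      ((card_filter_le _ _).trans (by rw [card_range])).trans ht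
    have hpos : 1 ≤ pulls (fun s => A s ω) t a := by
      rw [Nat.one_le_iff_ne_zero]
      intro h0
      have hempty := card_eq_zero.1 h0
      rw [h0, armSum, hempty] at hω
      simp at hω
    rw [Set.mem_iUnion₂]
    exact ⟨((a, i), t, pulls (fun s => A s ω) t a), by simp [I, hle, hpos, Nat.lt_succ_of_le ht],
      rfl, hω⟩
  have hS : ∀ q ∈ I, P (S q) ≤ ENNReal.ofReal (2 * Real.exp (-(4 * Real.log T))) := by
    rintro ⟨⟨a, i⟩, t, N⟩ hq
    simp only [I, mem_product, mem_univ, true_and, mem_range, mem_Icc] at hq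
    exact h.measure_abs_armSum_gt_le a (hw a i) (hf a i) (Nat.le_of_lt_succ hq.1) hq.2.1
      (Real.log_nonneg hT')
  have hexp : Real.exp (-(4 * Real.log T)) = 1 / T ^ 4 := by
    rw [Real.exp_neg, one_div, mul_comm, Real.exp_mul, Real.exp_log (by linarith)]
    norm_cast
  refine (measure_mono hsub).trans ((measure_biUnion_finset_le I S).trans
    ((sum_le_sum hS).trans ?_))
  rw [sum_const, nsmul_eq_mul, ← ENNReal.ofReal_natCast, ← ENNReal.ofReal_mul (Nat.cast_nonneg _),
    hexp]
  refine ENNReal.ofReal_le_ofReal ?_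
  have hcard : (I.card : ℝ) = (n * Fintype.card ι) * ((T + 1) * T) := by
    simp [I]
  rw [hcard]
  have hT0 : (0 : ℝ) < T := by linarith
  have hTT : ((T : ℝ) + 1) * T ≤ 2 * T ^ 2 := by nlinarith
  calc (n * Fintype.card ι : ℝ) * ((T + 1) * T) * (2 * (1 / (T : ℝ) ^ 4))
      ≤ (n * Fintype.card ι : ℝ) * (2 * T ^ 2) * (2 * (1 / (T : ℝ) ^ 4)) := by gcongr
    _ = 4 * (n * Fintype.card ι : ℝ) / T ^ 2 := by
        field_simp
        ring

end UnionBound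

/-! ### Identification of the means -/

section Environment

variable {n K L : ℕ} {E : Env n K L} {a : Fin n}

theorem Env.prob_nonneg (E : Env n K L) (a : Fin n) (m : Fin K) (y : Fin L) (o : Bool) :
    0 ≤ E.prob a m y o := ENNReal.toReal_nonneg

theorem Env.expect_eq_sum (E : Env n K L) (a : Fin n) (f : Fin K × Fin L × Bool → ℝ) :
    E.expect a f =
      ∑ m, ∑ y, (E.prob a m y true * f (m, y, true) + E.prob a m y false * f (m, y, false)) := by
  simp [Env.expect, Fintype.sum_prod_type, Env.prob]

theorem Env.probY_eq (E : Env n K L) (a : Fin n) (y : Fin L) :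
    E.probY a y = E.probYO a y true + E.probYO a y false := by
  simp [Env.probY, Env.probYO, sum_add_distrib]

theorem Env.probYO_nonneg (E : Env n K L) (a : Fin n) (y : Fin L) (o : Bool) :
    0 ≤ E.probYO a y o := sum_nonneg fun _ _ => E.prob_nonneg _ _ _ _

theorem Env.probY_nonneg (E : Env n K L) (a : Fin n) (y : Fin L) : 0 ≤ E.probY a y := by
  rw [E.probY_eq]
  exact add_nonneg (E.probYO_nonneg _ _ _) (E.probYO_nonneg _ _ _)

theorem Env.sum_probY (E : Env n K L) (a : Fin n) : ∑ y, E.probY a y = 1 := by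
  have h := E.sum_law a
  rw [Fintype.sum_prod_type] at h
  simp only [Fintype.sum_prod_type] at h
  rw [sum_comm] at h
  exact h

theorem Env.probY_le_one (E : Env n K L) (a : Fin n) (y : Fin L) : E.probY a y ≤ 1 := by
  rw [← E.sum_probY a]
  exact single_le_sum (f := E.probY a) (fun y _ => E.probY_nonneg a y) (mem_univ y)

theorem Env.exists_probY_pos (E : Env n K L) (a : Fin n) : ∃ y, 0 < E.probY a y := by
  by_contra! h
  have : ∑ y, E.probY a y ≤ 0 := sum_nonpos fun y _ => h y
  linarith [E.sum_probY a]

theorem Env.prob_eq_zero_of_not_probY_pos (E : Env n K L) {a : Fin n} {y : Fin L}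
    (hy : ¬ 0 < E.probY a y) (m : Fin K) (o : Bool) : E.prob a m y o = 0 := by
  have h0 : E.probY a y = 0 := le_antisymm (not_lt.1 hy) (E.probY_nonneg a y)
  rw [Env.probY, sum_eq_zero_iff_of_nonneg
    fun m _ => sum_nonneg fun o _ => E.prob_nonneg _ _ _ _] at h0
  have := h0 m (mem_univ m)
  rw [sum_eq_zero_iff_of_nonneg fun o _ => E.prob_nonneg _ _ _ _] at this
  exact this o (mem_univ o)

theorem Env.obsProb_le_one (E : Env n K L) (a : Fin n) (y : Fin L) : E.obsProb a y ≤ 1 := by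
  refine div_le_one_of_le₀ ?_ (E.probY_nonneg a y)
  rw [E.probY_eq]
  linarith [E.probYO_nonneg a y false]

theorem Env.obsProb_nonneg (E : Env n K L) (a : Fin n) (y : Fin L) : 0 ≤ E.obsProb a y :=
  div_nonneg (E.probYO_nonneg a y true) (E.probY_nonneg a y)

theorem Env.probY_mul_obsProb (E : Env n K L) (a : Fin n) (y : Fin L) :
    E.probY a y * E.obsProb a y = E.probYO a y true := by
  by_cases hy : 0 < E.probY a y
  · rw [Env.obsProb, mul_div_cancel₀ _ hy.ne']
  · rw [Env.probYO, sum_eq_zero fun m _ => E.prob_eq_zero_of_not_probY_pos hy m true,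
      le_antisymm (not_lt.1 hy) (E.probY_nonneg a y), zero_mul]

/-- Completeness says that `Θ_a` is injective on the vectors supported on possible outcomes. -/
theorem Env.IsComplete.injOn (hE : E.IsComplete) (a : Fin n) :
    ∀ g, E.theta a *ᵥ g = 0 → ∀ y ∈ {y | 0 < E.probY a y}, g y = 0 :=
  fun g hg y hy => hE a g (fun m => congrFun hg m) y hy

theorem Env.theta_eq_zero (E : Env n K L) (a : Fin n) :
    ∀ m, ∀ y ∉ {y | 0 < E.probY a y}, E.theta a m y = 0 :=
  fun m _ hy => E.prob_eq_zero_of_not_probY_pos hy m true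

theorem Env.IsComplete.obsProb_pos (hE : E.IsComplete) {y : Fin L} (hy : 0 < E.probY a y) :
    0 < E.obsProb a y := by
  refine lt_of_le_of_ne (E.obsProb_nonneg a y) fun h0 => ?_
  have h1 : E.probYO a y true = 0 := by rw [← E.probY_mul_obsProb, ← h0, mul_zero]
  rw [Env.probYO, sum_eq_zero_iff_of_nonneg fun m _ => E.prob_nonneg _ _ _ _] at h1
  have := hE a (Pi.single y 1) (fun m => by
    simp [Pi.single_apply, h1 m (mem_univ m)]) y hy
  simp at this

theorem Env.gammaMin_le (E : Env n K L) {y : Fin L} (hy : 0 < E.probY a y) :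
    E.gammaMin a ≤ E.obsProb a y :=
  ciInf_le (f := fun y : {y : Fin L // 0 < E.probY a y} => E.obsProb a y)
    (Set.finite_range _).bddBelow ⟨y, hy⟩

theorem Env.exists_obsProb_eq_gammaMin (E : Env n K L) (a : Fin n) :
    ∃ y, 0 < E.probY a y ∧ E.obsProb a y = E.gammaMin a := by
  obtain ⟨y, hy⟩ := E.exists_probY_pos a
  have : Nonempty {y : Fin L // 0 < E.probY a y} := ⟨⟨y, hy⟩⟩
  obtain ⟨z, hz⟩ := exists_eq_ciInf_of_finite
    (f := fun y : {y : Fin L // 0 < E.probY a y} => E.obsProb a y)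
  exact ⟨z, z.2, hz⟩

theorem Env.IsComplete.gammaMin_pos (hE : E.IsComplete) (a : Fin n) : 0 < E.gammaMin a := by
  obtain ⟨y, hy, h⟩ := E.exists_obsProb_eq_gammaMin a
  exact h ▸ hE.obsProb_pos hy

theorem Env.gammaMin_le_one (E : Env n K L) (a : Fin n) : E.gammaMin a ≤ 1 := by
  obtain ⟨y, hy, h⟩ := E.exists_obsProb_eq_gammaMin a
  exact h ▸ E.obsProb_le_one a y

/-- The inverse observation probability `1 / γ_{y,a}`, with the value `1` for outcomes that arm `a`
cannot produce. These are the values that the algorithm estimates by `xHat`. -/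
noncomputable def Env.invObs (E : Env n K L) (a : Fin n) (y : Fin L) : ℝ :=
  open Classical in if 0 < E.probY a y then (E.obsProb a y)⁻¹ else 1

theorem Env.IsComplete.one_le_invObs (hE : E.IsComplete) (a : Fin n) (y : Fin L) :
    1 ≤ E.invObs a y := by
  unfold Env.invObs
  split_ifs with hy
  · exact (one_le_inv₀ (hE.obsProb_pos hy)).2 (E.obsProb_le_one a y)
  · exact le_rfl

theorem Env.IsComplete.invObs_le (hE : E.IsComplete) (a : Fin n) (y : Fin L) :
    E.invObs a y ≤ 1 / E.gammaMin a := by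
  rw [one_div]
  unfold Env.invObs
  split_ifs with hy
  · exact inv_anti₀ (hE.gammaMin_pos a) (E.gammaMin_le hy)
  · exact (one_le_inv₀ (hE.gammaMin_pos a)).2 (E.gammaMin_le_one a)

theorem Env.exists_invObs_eq (E : Env n K L) (a : Fin n) :
    ∃ y, E.invObs a y = 1 / E.gammaMin a := by
  obtain ⟨y, hy, h⟩ := E.exists_obsProb_eq_gammaMin a
  exact ⟨y, by rw [Env.invObs, if_pos hy, h, one_div]⟩

/-- Inverse probability weighting: `P(Y = y) = P(Y = y, O = 1) / γ_{y,a}`. -/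
theorem Env.IsComplete.probYO_mul_invObs (hE : E.IsComplete) (a : Fin n) (y : Fin L) :
    E.probYO a y true * E.invObs a y = E.probY a y := by
  rw [← E.probY_mul_obsProb, Env.invObs]
  split_ifs with hy
  · rw [mul_inv_cancel_right₀ (hE.obsProb_pos hy).ne']
  · rw [le_antisymm (not_lt.1 hy) (E.probY_nonneg a y), zero_mul, zero_mul]

/-- By conditional independence of `M` and `O` given `Y`, the inverse odds ratios solve the linear
system with matrix `Θ_a` and right-hand side `P(M = m, O = 0)`. -/
theorem Env.IsMNAR.prob_false_eq (hM : E.IsMNAR) (hE : E.IsComplete) (a : Fin n) (m : Fin K)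
    (y : Fin L) : E.prob a m y false = E.prob a m y true * (E.invObs a y - 1) := by
  by_cases hy : 0 < E.probY a y
  · have h := hM a m y true
    rw [← E.probY_mul_obsProb, mul_comm (E.probY a y), ← mul_assoc] at h
    have h1 := mul_right_cancel₀ hy.ne' h
    have h2 : E.probMY a m y = E.prob a m y true + E.prob a m y false := by simp [Env.probMY]
    have h3 := (hE.obsProb_pos hy).ne'
    rw [Env.invObs, if_pos hy]
    have h4 : E.prob a m y true * (E.obsProb a y)⁻¹ = E.probMY a m y := by
      rw [h1, mul_inv_cancel_right₀ h3]
    rw [mul_sub, h4, h2]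
    ring
  · rw [E.prob_eq_zero_of_not_probY_pos hy, E.prob_eq_zero_of_not_probY_pos hy, zero_mul]

theorem Env.infNorm_theta_le_one (E : Env n K L) (a : Fin n) : infNorm (E.theta a) ≤ 1 := by
  refine infNorm_le_of_row_sum_le zero_le_one fun m => ?_
  have h := E.sum_law a
  rw [Fintype.sum_prod_type] at h
  calc ∑ y, |E.theta a m y| ≤ ∑ q : Fin L × Bool, (E.law a (m, q)).toReal := by
        rw [Fintype.sum_prod_type]
        refine sum_le_sum fun y _ => ?_
        rw [show |E.theta a m y| = E.prob a m y true from abs_of_nonneg (E.prob_nonneg _ _ _ _),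
          Fintype.sum_bool]
        exact le_add_of_nonneg_right ENNReal.toReal_nonneg
    _ ≤ 1 := by
        rw [← h]
        exact single_le_sum (f := fun m => ∑ q : Fin L × Bool, (E.law a (m, q)).toReal)
          (fun m _ => sum_nonneg fun q _ => ENNReal.toReal_nonneg) (mem_univ m)

theorem Env.IsComplete.infNorm_theta_pos (hE : E.IsComplete) (a : Fin n) :
    0 < infNorm (E.theta a) := by
  obtain ⟨y, hy⟩ := E.exists_probY_pos a
  have hpos : 0 < E.probYO a y true := by
    rw [← E.probY_mul_obsProb]
    exact mul_pos hy (hE.obsProb_pos hy)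
  obtain ⟨m, hm⟩ : ∃ m, 0 < E.prob a m y true := by
    by_contra! h
    exact absurd (sum_nonpos fun m _ => h m) (not_le.2 hpos)
  exact hm.trans_le ((le_abs_self _).trans (abs_entry_le_infNorm (E.theta a) m y))

theorem one_le_condNumber {A : Matrix (Fin K) (Fin L) ℝ} (hA : 0 < infNorm A) :
    1 ≤ condNumber A := by
  have h : infNorm A ≤ infNorm A * infNorm (pinv A) * infNorm A := by
    conv_lhs => rw [← (isPseudoInverse_pinv A).mul_mul_left]
    exact (infNorm_mul_le _ _).trans
      (mul_le_mul_of_nonneg_right (infNorm_mul_le _ _) (infNorm_nonneg _))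
  exact le_of_mul_le_mul_right (by simpa [condNumber] using h) hA

theorem Env.gammaMin_le_sum (E : Env n K L) (a : Fin n) :
    E.gammaMin a ≤ ∑ y, E.probY a y * E.obsProb a y := by
  calc E.gammaMin a = ∑ y, E.probY a y * E.gammaMin a := by
        rw [← sum_mul, E.sum_probY, one_mul]
    _ ≤ _ := sum_le_sum fun y _ => by
        by_cases hy : 0 < E.probY a y
        · exact mul_le_mul_of_nonneg_left (E.gammaMin_le hy) hy.le
        · rw [le_antisymm (not_lt.1 hy) (E.probY_nonneg a y), zero_mul, zero_mul]

theorem Env.sum_probY_mul_obsProb_le_one (E : Env n K L) (a : Fin n) :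
    ∑ y, E.probY a y * E.obsProb a y ≤ 1 := by
  rw [← E.sum_probY a]
  exact sum_le_sum fun y _ => mul_le_of_le_one_right (E.probY_nonneg a y) (E.obsProb_le_one a y)

theorem Env.IsComplete.one_le_complexity (hE : E.IsComplete) (C : Fin n → ℝ) (a : Fin n) :
    1 ≤ E.complexity C a := by
  have hK : (1 : ℝ) ≤ K := by
    rcases Nat.eq_zero_or_pos K with rfl | h
    · obtain ⟨x, -⟩ := (E.law a).support_nonempty
      exact x.1.elim0
    · exact_mod_cast h
  refine le_max_of_le_right ?_
  have hg := hE.gammaMin_pos a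
  have hs := E.gammaMin_le_sum a
  have h1 : Real.sqrt (∑ y, E.probY a y * E.obsProb a y) ≤ 1 :=
    Real.sqrt_le_one.2 (E.sum_probY_mul_obsProb_le_one a)
  have h0 : 0 < Real.sqrt (∑ y, E.probY a y * E.obsProb a y) := Real.sqrt_pos.2 (by linarith)
  rw [one_le_div (by positivity)]
  exact (mul_le_one₀ (E.gammaMin_le_one a) h0.le h1).trans hK

theorem Env.IsNormalized.abs_value_le_one (hN : E.IsNormalized) (y : Fin L) : |E.value y| ≤ 1 :=
  hN ▸ single_le_sum (f := fun y => |E.value y|) (fun _ _ => abs_nonneg _) (mem_univ y)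

theorem Env.IsNormalized.abs_mean_le_one (hN : E.IsNormalized) (a : Fin n) : |E.mean a| ≤ 1 := by
  calc |E.mean a| ≤ ∑ y, |E.value y * E.probY a y| := abs_sum_le_sum_abs _ _
    _ ≤ ∑ y, |E.value y| := sum_le_sum fun y _ => by
        rw [abs_mul, abs_of_nonneg (E.probY_nonneg a y)]
        exact mul_le_of_le_one_right (abs_nonneg _) (E.probY_le_one a y)
    _ = 1 := hN

end Environment

/-! ### The statistics of the algorithm as sample means -/

section Statistics

variable {n K L : ℕ} {E : Env n K L} {a : Fin n}

/-- The functions of a sample `(M, Y, O)` whose means control the algorithm: the indicator of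
`(M, Y, O) = (m, y, 1)` with mean `Θ_a[m, y]`; the residual of row `m` of the linear system for the
inverse odds ratios, with mean zero; the inverse probability weighted outcome, with mean `μ_a`
(label `true`); and the indicator of `O = 1` (label `false`). -/
noncomputable def testFun (E : Env n K L) (a : Fin n) :
    (Fin K × Fin L) ⊕ Fin K ⊕ Bool → Fin K × Fin L × Bool → ℝ
  | .inl q, x => if x = (q.1, q.2, true) then 1 else 0
  | .inr (.inl m), x => if x.1 = m then (if x.2.2 then -(E.invObs a x.2.1 - 1) else 1) else 0
  | .inr (.inr true), x => if x.2.2 then E.value x.2.1 * E.invObs a x.2.1 else 0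
  | .inr (.inr false), x => if x.2.2 then 1 else 0

/-- The left end of an interval containing the values of `testFun`. -/
noncomputable def testLow (E : Env n K L) (a : Fin n) : (Fin K × Fin L) ⊕ Fin K ⊕ Bool → ℝ
  | .inl _ => 0
  | .inr (.inl _) => 1 - 1 / E.gammaMin a
  | .inr (.inr true) => -(1 / E.gammaMin a)
  | .inr (.inr false) => 0

/-- The length of an interval containing the values of `testFun`. -/
noncomputable def testWidth (E : Env n K L) (a : Fin n) : (Fin K × Fin L) ⊕ Fin K ⊕ Bool → ℝ
  | .inl _ => 1
  | .inr (.inl _) => 1 / E.gammaMin a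
  | .inr (.inr true) => 2 / E.gammaMin a
  | .inr (.inr false) => 1

theorem Env.IsComplete.testWidth_pos (hE : E.IsComplete) (a : Fin n)
    (i : (Fin K × Fin L) ⊕ Fin K ⊕ Bool) : 0 < testWidth E a i := by
  have hg := hE.gammaMin_pos a
  rcases i with i | i | (i | i) <;> simp only [testWidth] <;> positivity

theorem Env.IsComplete.testFun_mem_Icc (hE : E.IsComplete) (hN : E.IsNormalized) (a : Fin n)
    (i : (Fin K × Fin L) ⊕ Fin K ⊕ Bool) (x : Fin K × Fin L × Bool) :
    testFun E a i x ∈ Set.Icc (testLow E a i) (testLow E a i + testWidth E a i) := by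
  have hx1 := hE.one_le_invObs a x.2.1
  have hx2 := hE.invObs_le a x.2.1
  rcases i with i | i | (i | i)
  · simp only [testFun, testLow, testWidth]
    split_ifs <;> constructor <;> norm_num
  · simp only [testFun, testLow, testWidth]
    split_ifs <;> constructor <;> linarith
  · simp only [testFun, testLow, testWidth]
    split_ifs <;> constructor <;> norm_num
  · have h : |testFun E a (.inr (.inr true)) x| ≤ 1 / E.gammaMin a := by
      simp only [testFun]
      split_ifs
      · rw [abs_mul, abs_of_nonneg (zero_le_one.trans hx1)]
        exact (mul_le_of_le_one_left (zero_le_one.trans hx1) (hN.abs_value_le_one _)).trans hx2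
      · rw [abs_zero]
        linarith
    rw [abs_le] at h
    refine ⟨h.1, h.2.trans (le_of_eq ?_)⟩
    simp only [testLow, testWidth]
    ring

theorem expect_testFun_entry (E : Env n K L) (a : Fin n) (m : Fin K) (y : Fin L) :
    E.expect a (testFun E a (.inl (m, y))) = E.theta a m y := by
  simp only [Env.expect, testFun, mul_ite, mul_one, mul_zero]
  rw [Fintype.sum_ite_eq']
  rfl

theorem expect_testFun_residual (hM : E.IsMNAR) (hE : E.IsComplete) (a : Fin n) (m : Fin K) :
    E.expect a (testFun E a (.inr (.inl m))) = 0 := by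
  rw [E.expect_eq_sum]
  refine sum_eq_zero fun m' _ => sum_eq_zero fun y _ => ?_
  rw [hM.prob_false_eq hE]
  by_cases h : m' = m
  · simp only [testFun, if_pos h, if_true, Bool.false_eq_true, if_false]
    ring
  · simp [testFun, h]

theorem expect_testFun_mean (hE : E.IsComplete) (a : Fin n) :
    E.expect a (testFun E a (.inr (.inr true))) = E.mean a := by
  rw [E.expect_eq_sum, sum_comm, Env.mean]
  refine sum_congr rfl fun y _ => ?_
  rw [← hE.probYO_mul_invObs, Env.probYO, sum_mul, mul_sum]
  refine sum_congr rfl fun m _ => ?_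
  simp only [testFun, if_true, Bool.false_eq_true, if_false]
  ring

theorem expect_testFun_observed (E : Env n K L) (a : Fin n) :
    E.expect a (testFun E a (.inr (.inr false))) = ∑ y, E.probY a y * E.obsProb a y := by
  rw [E.expect_eq_sum, sum_comm]
  refine sum_congr rfl fun y _ => ?_
  rw [E.probY_mul_obsProb, Env.probYO]
  refine sum_congr rfl fun m _ => ?_
  simp [testFun]

variable {A : ℕ → Fin n} {X : ℕ → Fin K × Fin L × Bool} {t : ℕ}

theorem feedback_eq_some (x : Fin K × Fin L × Bool) (m : Fin K) (y : Fin L) :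
    feedback x = (m, some y) ↔ x = (m, y, true) := by
  obtain ⟨m', y', _ | _⟩ := x <;> simp [feedback]

theorem feedback_eq_none (x : Fin K × Fin L × Bool) (m : Fin K) :
    feedback x = (m, none) ↔ x.1 = m ∧ x.2.2 = false := by
  obtain ⟨m', y', _ | _⟩ := x <;> simp [feedback]

theorem feedback_ne_none (x : Fin K × Fin L × Bool) : (feedback x).2 ≠ none ↔ x.2.2 = true := by
  obtain ⟨m', y', _ | _⟩ := x <;> simp [feedback]

theorem feedbackPulls_some (E : Env n K L) (A : ℕ → Fin n) (X : ℕ → Fin K × Fin L × Bool) (t : ℕ)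
    (a : Fin n) (m : Fin K) (y : Fin L) :
    (feedbackPulls A (fun s => feedback (X s)) t a (m, some y) : ℝ) =
      armSum A X t a (testFun E a (.inl (m, y))) := by
  simp only [feedbackPulls, armSum, testFun, feedback_eq_some]
  rw [← filter_filter, card_filter]
  push_cast
  rfl

theorem obsPulls_eq (E : Env n K L) (A : ℕ → Fin n) (X : ℕ → Fin K × Fin L × Bool) (t : ℕ)
    (a : Fin n) :
    (obsPulls A (fun s => feedback (X s)) t a : ℝ) =
      armSum A X t a (testFun E a (.inr (.inr false))) := by
  simp only [obsPulls, armSum, testFun, feedback_ne_none]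
  rw [← filter_filter, card_filter]
  push_cast
  rfl

/-- The residual of the empirical linear system at the true inverse odds ratios is a sample mean. -/
theorem bHat_sub_thetaHat_mulVec (E : Env n K L) (A : ℕ → Fin n) (X : ℕ → Fin K × Fin L × Bool)
    (t : ℕ) (a : Fin n) (m : Fin K) :
    bHat A (fun s => feedback (X s)) t a m -
      (thetaHat A (fun s => feedback (X s)) t a *ᵥ fun y => E.invObs a y - 1) m =
      armSum A X t a (testFun E a (.inr (.inl m))) / pulls A t a := by
  have hb : (feedbackPulls A (fun s => feedback (X s)) t a (m, none) : ℝ) =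
      ∑ s ∈ range t with A s = a, if (X s).1 = m ∧ (X s).2.2 = false then 1 else 0 := by
    simp only [feedbackPulls, feedback_eq_none]
    rw [← filter_filter, card_filter]
    push_cast
    rfl
  simp only [bHat, thetaHat, mulVec, dotProduct, of_apply, hb, feedbackPulls_some E]
  simp only [div_mul_eq_mul_div, ← sum_div, ← sub_div]
  congr 1
  simp only [armSum, sum_mul]
  rw [sum_comm, ← sum_sub_distrib]
  refine sum_congr rfl fun s _ => ?_
  obtain ⟨m', y', o⟩ := X s
  cases o
  · simp [testFun]
  · by_cases hm : m' = m
    · simp [testFun, hm]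
    · simp [testFun, hm]

theorem sum_thetaHat_le_one (A : ℕ → Fin n) (Z : ℕ → Feedback K L) (t : ℕ) (a : Fin n)
    (y : Fin L) : ∑ m, thetaHat A Z t a m y ≤ 1 := by
  simp only [thetaHat, of_apply, ← sum_div]
  refine div_le_one_of_le₀ ?_ (Nat.cast_nonneg _)
  rw [← Nat.cast_sum, Nat.cast_le]
  unfold feedbackPulls pulls
  rw [← card_biUnion]
  · refine card_le_card fun s hs => ?_
    simp only [mem_biUnion, mem_univ, true_and, mem_filter] at hs ⊢
    obtain ⟨m, h⟩ := hs
    exact ⟨h.1, h.2.1⟩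
  · intro m _ m' _ hne
    refine disjoint_left.2 fun s hs hs' => hne ?_
    have h1 := (mem_filter.1 hs).2.2
    have h2 := (mem_filter.1 hs').2.2
    exact congrArg Prod.fst (h1.symm.trans h2)

theorem thetaHat_nonneg (A : ℕ → Fin n) (Z : ℕ → Feedback K L) (t : ℕ) (a : Fin n)
    (m : Fin K) (y : Fin L) : 0 ≤ thetaHat A Z t a m y :=
  div_nonneg (Nat.cast_nonneg _) (Nat.cast_nonneg _)

/-- The sample mean of the inverse probability weighted outcome is the estimate of `μ_a` that would
use the true observation probabilities. -/
theorem sum_value_mul_invObs_mul_thetaHat (E : Env n K L) (A : ℕ → Fin n)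
    (X : ℕ → Fin K × Fin L × Bool) (t : ℕ) (a : Fin n) :
    ∑ y, E.value y * ∑ m, E.invObs a y * thetaHat A (fun s => feedback (X s)) t a m y =
      armSum A X t a (testFun E a (.inr (.inr true))) / pulls A t a := by
  simp only [thetaHat, of_apply, feedbackPulls_some E, mul_div_assoc', ← sum_div]
  congr 1
  simp only [armSum, mul_sum]
  rw [sum_congr rfl fun y _ => sum_comm, sum_comm]
  refine sum_congr rfl fun s _ => ?_
  obtain ⟨m', y', o⟩ := X s
  cases o
  · simp [testFun]
  · simp only [testFun, Prod.mk.injEq, and_true, mul_ite, mul_one, mul_zero, if_true]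
    rw [sum_eq_single y' (fun y _ hy => ?_) (by simp)]
    · simp
    · exact sum_eq_zero fun m _ => by simp [Ne.symm hy]

end Statistics

/-! ### Confidence bounds for one arm -/

section Confidence

variable {n K L T t : ℕ} {E : Env n K L} {C : Fin n → ℝ} {α : ℝ} {a : Fin n}
  {A : ℕ → Fin n} {X : ℕ → Fin K × Fin L × Bool}

/-- All sample means at time `t` for arm `a` are within a multiple `r` of the width from their
means, and no impossible sample has occurred. -/
structure IsAccurate (E : Env n K L) (A : ℕ → Fin n) (X : ℕ → Fin K × Fin L × Bool) (t : ℕ)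
    (a : Fin n) (r : ℝ) : Prop where
  deviation : ∀ i, |armSum A X t a (testFun E a i) / pulls A t a - E.expect a (testFun E a i)| ≤
    testWidth E a i * r
  possible : ∀ s < t, E.law (A s) (X s) ≠ 0

/-- The radius `r` of the sample means is small enough for the perturbation argument. -/
structure IsSmallRadius (K L : ℕ) (C θ γ r : ℝ) : Prop where
  nonneg : 0 ≤ r
  pinv : (K * K + 1) * (C / θ * (L * r)) ≤ 1 / 20
  norm : L * r ≤ θ / 10
  weight : 6 / 5 * (C / θ) * r ≤ 1 / 10
  observed : r ≤ γ / 2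

variable {r : ℝ}

theorem IsAccurate.infNorm_sub_le (h : IsAccurate E A X t a r) (hr : 0 ≤ r) :
    infNorm (thetaHat A (fun s => feedback (X s)) t a - E.theta a) ≤ L * r := by
  refine infNorm_le_of_entry_le hr fun m y => ?_
  have := h.deviation (.inl (m, y))
  rw [expect_testFun_entry] at this
  simpa only [Matrix.sub_apply, thetaHat, of_apply, feedbackPulls_some E, testWidth, one_mul]
    using this

theorem IsAccurate.thetaHat_eq_zero (h : IsAccurate E A X t a r) :
    ∀ m, ∀ y ∉ {y | 0 < E.probY a y}, thetaHat A (fun s => feedback (X s)) t a m y = 0 := by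
  intro m y hy
  have h0 : feedbackPulls A (fun s => feedback (X s)) t a (m, some y) = 0 := by
    refine card_eq_zero.2 (filter_eq_empty_iff.2 fun s hs => ?_)
    rintro ⟨ha, hf⟩
    rw [feedback_eq_some] at hf
    have h1 := h.possible s (mem_range.1 hs)
    rw [ha, hf] at h1
    have h2 := E.prob_eq_zero_of_not_probY_pos hy m true
    exact h1 (((ENNReal.toReal_eq_zero_iff _).1 h2).resolve_right ((E.law a).apply_ne_top _))
  simp [thetaHat, h0]

theorem infNorm_pinv_theta_le (hE : E.IsComplete) (hC : condNumber (E.theta a) ≤ C a) :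
    infNorm (pinv (E.theta a)) ≤ C a / infNorm (E.theta a) := by
  rw [le_div_iff₀ (hE.infNorm_theta_pos a), mul_comm]
  exact hC

/-- The estimates of the inverse observation probabilities. The error is `Θ̂†` applied to the
residual of the empirical system at the true solution, because `Θ̂† Θ̂` is still the coordinate
projection onto the possible outcomes. -/
theorem IsAccurate.abs_xHat_sub_le (h : IsAccurate E A X t a r) (hM : E.IsMNAR)
    (hE : E.IsComplete) (hC : condNumber (E.theta a) ≤ C a)
    (hs : IsSmallRadius K L (C a) (infNorm (E.theta a)) (E.gammaMin a) r) (y : Fin L) :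
    |xHat A (fun s => feedback (X s)) t a y - E.invObs a y| ≤
      6 / 5 * (C a / infNorm (E.theta a)) * (1 / E.gammaMin a * r) := by
  have hp := infNorm_pinv_theta_le hE hC
  have hd := h.infNorm_sub_le hs.nonneg
  have h0' := h.thetaHat_eq_zero
  set Θ' := thetaHat A (fun s => feedback (X s)) t a
  have hg := hE.gammaMin_pos a
  have hr := hs.nonneg
  have hsm : (K * K + 1) * (infNorm (pinv (E.theta a)) * infNorm (Θ' - E.theta a)) ≤ 1 / 20 := by
    refine le_trans (mul_le_mul_of_nonneg_left ?_ (by positivity)) hs.pinv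
    exact mul_le_mul hp hd (infNorm_nonneg _) ((infNorm_nonneg _).trans hp)
  have hsm' : infNorm (pinv (E.theta a)) * infNorm (Θ' - E.theta a) < 1 := by
    have h1 : 0 ≤ infNorm (pinv (E.theta a)) * infNorm (Θ' - E.theta a) :=
      mul_nonneg (infNorm_nonneg _) (infNorm_nonneg _)
    have h2 : (0 : ℝ) ≤ K * K := by positivity
    nlinarith
  have hproj := pinv_mul_self_eq h0'
    (injOn_of_perturbation (E.theta_eq_zero a) h0' (hE.injOn a) hsm')
  have hnorm := infNorm_pinv_le (E.theta_eq_zero a) h0' (hE.injOn a) hsm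
  set b := bHat A (fun s => feedback (X s)) t a
  set v : Fin L → ℝ := fun y => E.invObs a y - 1
  have hv : (pinv Θ' * Θ') *ᵥ v = v := by
    rw [hproj]
    ext z
    rw [mulVec_diagonal]
    by_cases hz : z ∈ {y | 0 < E.probY a y}
    · rw [Set.indicator_of_mem hz, Pi.one_apply, one_mul]
    · rw [Set.indicator_of_notMem hz, zero_mul]
      have : E.invObs a z = 1 := if_neg hz
      simp [v, this]
  have hx : xHat A (fun s => feedback (X s)) t a y - E.invObs a y =
      (pinv Θ' *ᵥ (b - Θ' *ᵥ v)) y := by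
    rw [mulVec_sub, mulVec_mulVec, hv]
    simp only [xHat, Pi.sub_apply, v]
    ring
  have hres : ‖b - Θ' *ᵥ v‖ ≤ 1 / E.gammaMin a * r := by
    refine (pi_norm_le_iff_of_nonneg (by positivity)).2 fun m => ?_
    have := h.deviation (.inr (.inl m))
    rw [expect_testFun_residual hM hE, sub_zero, ← bHat_sub_thetaHat_mulVec] at this
    exact this
  rw [hx, ← Real.norm_eq_abs]
  refine (norm_le_pi_norm _ y).trans ((norm_mulVec_le _ _).trans ?_)
  refine mul_le_mul (hnorm.trans (mul_le_mul_of_nonneg_left hp (by norm_num))) hres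
    (norm_nonneg _) ?_
  have := (infNorm_nonneg _).trans hp
  positivity

theorem IsAccurate.iSup_xHat_mem (h : IsAccurate E A X t a r) (hM : E.IsMNAR)
    (hE : E.IsComplete) (hC : condNumber (E.theta a) ≤ C a)
    (hs : IsSmallRadius K L (C a) (infNorm (E.theta a)) (E.gammaMin a) r) :
    (⨆ y, xHat A (fun s => feedback (X s)) t a y) ∈
      Set.Icc (9 / 10 * (1 / E.gammaMin a)) (11 / 10 * (1 / E.gammaMin a)) := by
  have hg := hE.gammaMin_pos a
  have hx : ∀ y, |xHat A (fun s => feedback (X s)) t a y - E.invObs a y| ≤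
      1 / 10 * (1 / E.gammaMin a) := fun y => by
    refine (h.abs_xHat_sub_le hM hE hC hs y).trans ?_
    rw [mul_left_comm, mul_comm]
    exact mul_le_mul_of_nonneg_right hs.weight (by positivity)
  obtain ⟨z, hz⟩ := E.exists_invObs_eq a
  have : Nonempty (Fin L) := ⟨z⟩
  constructor
  · have h1 := (abs_le.1 (hx z)).1
    have h2 : xHat A (fun s => feedback (X s)) t a z ≤ ⨆ y, xHat A (fun s => feedback (X s)) t a y :=
      le_ciSup (Set.finite_range _).bddAbove z
    linarith
  · refine ciSup_le fun y => ?_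
    have h1 := (abs_le.1 (hx y)).2
    have h2 := hE.invObs_le a y
    linarith

theorem IsAccurate.abs_muHat_sub_le (h : IsAccurate E A X t a r) (hN : E.IsNormalized)
    (hM : E.IsMNAR) (hE : E.IsComplete) (hC : condNumber (E.theta a) ≤ C a)
    (hs : IsSmallRadius K L (C a) (infNorm (E.theta a)) (E.gammaMin a) r) :
    |muHat E.value A (fun s => feedback (X s)) t a - E.mean a| ≤
      6 / 5 * (C a / infNorm (E.theta a)) * (1 / E.gammaMin a * r) + 2 / E.gammaMin a * r := by
  have hx := h.abs_xHat_sub_le hM hE hC hs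
  set Z : ℕ → Feedback K L := fun s => feedback (X s)
  set δ := 6 / 5 * (C a / infNorm (E.theta a)) * (1 / E.gammaMin a * r)
  have h2 := h.deviation (.inr (.inr true))
  rw [expect_testFun_mean hE, ← sum_value_mul_invObs_mul_thetaHat] at h2
  have hdec : muHat E.value A Z t a - E.mean a =
      ∑ y, E.value y * ((xHat A Z t a y - E.invObs a y) * ∑ m, thetaHat A Z t a m y) +
        ((∑ y, E.value y * ∑ m, E.invObs a y * thetaHat A Z t a m y) - E.mean a) := by
    rw [← add_sub_assoc, ← sum_add_distrib, muHat]
    congr 1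
    refine sum_congr rfl fun y _ => ?_
    simp only [pHat, ← mul_sum]
    ring
  rw [hdec]
  refine (abs_add_le _ _).trans (add_le_add ?_ h2)
  calc |∑ y, E.value y * ((xHat A Z t a y - E.invObs a y) * ∑ m, thetaHat A Z t a m y)|
      ≤ ∑ y, |E.value y| * δ := by
        refine (abs_sum_le_sum_abs _ _).trans (sum_le_sum fun y _ => ?_)
        have h3 : 0 ≤ ∑ m, thetaHat A Z t a m y := sum_nonneg fun m _ => thetaHat_nonneg _ _ _ _ _ _
        rw [abs_mul, abs_mul, abs_of_nonneg h3]
        refine mul_le_mul_of_nonneg_left ?_ (abs_nonneg _)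
        exact (mul_le_of_le_one_right (abs_nonneg _) (sum_thetaHat_le_one A Z t a y)).trans (hx y)
    _ = δ := by rw [← sum_mul, hN, one_mul]

/-- The upper confidence bound of an arm with accurate sample means exceeds the mean of the arm, by
at most a multiple of its complexity and of the inverse square root of the number of pulls. -/
theorem IsAccurate.ucb_bounds {R : ℝ} (h : IsAccurate E A X t a (3 / 2 * R))
    (hN : E.IsNormalized)
    (hM : E.IsMNAR) (hE : E.IsComplete) (hC : condNumber (E.theta a) ≤ C a)
    (hs : IsSmallRadius K L (C a) (infNorm (E.theta a)) (E.gammaMin a) (3 / 2 * R))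
    (hR : R = Real.sqrt (α * Real.log T / pulls A t a)) (hpulls : 0 < pulls A t a)
    (hα : 0 ≤ α * Real.log T) :
    E.mean a ≤ ucb E.value C α T A (fun s => feedback (X s)) t a ∧
      ucb E.value C α T A (fun s => feedback (X s)) t a - E.mean a ≤
        17 * (E.complexity C a * R) := by
  have hR0 : 0 ≤ R := hR ▸ Real.sqrt_nonneg _
  have hg := hE.gammaMin_pos a
  have hθ := hE.infNorm_theta_pos a
  have hθ1 := E.infNorm_theta_le_one a
  have hC1 : 1 ≤ C a := (one_le_condNumber hθ).trans hC
  have hL : (1 : ℝ) ≤ L := by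
    obtain ⟨y, -⟩ := E.exists_probY_pos a
    exact_mod_cast y.pos
  have hsup := h.iSup_xHat_mem hM hE hC hs
  have hmu := h.abs_muHat_sub_le hN hM hE hC hs
  have hdθ := h.infNorm_sub_le hs.nonneg
  have hobs := h.deviation (.inr (.inr false))
  rw [expect_testFun_observed, ← obsPulls_eq] at hobs
  set Z : ℕ → Feedback K L := fun s => feedback (X s)
  have hγ : 1 / gammaHat A Z t a = ⨆ y, xHat A Z t a y := by rw [gammaHat, one_div_one_div]
  rw [← hγ] at hsup
  set g := E.gammaMin a
  set θ := infNorm (E.theta a)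
  set θ' := infNorm (thetaHat A Z t a)
  set G := 1 / gammaHat A Z t a
  set q := L * C a / (g * θ) with hq
  have hq0 : 0 ≤ q := by positivity
  have hqC : C a / θ * (1 / g) ≤ q := by
    rw [hq, div_mul_div_comm, mul_one, mul_comm g θ]
    gcongr
    exact le_mul_of_one_le_left (by linarith) hL
  have hqg : 1 / g ≤ q := by
    refine le_trans ?_ hqC
    refine le_mul_of_one_le_left (by positivity) ?_
    rw [one_le_div hθ]
    linarith
  -- the norms of the empirical and the true matrix differ by at most a tenth
  have hθ'1 : θ' ≤ 11 / 10 * θ := by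
    have h1 : θ' ≤ infNorm (thetaHat A Z t a - E.theta a) + θ := by
      have := infNorm_add_le (thetaHat A Z t a - E.theta a) (E.theta a)
      rwa [sub_add_cancel] at this
    linarith [hs.norm]
  have hθ'2 : 9 / 10 * θ ≤ θ' := by
    have h1 : θ ≤ θ' + infNorm (thetaHat A Z t a - E.theta a) := by
      have := MNARBandit.infNorm_sub_le (thetaHat A Z t a) (thetaHat A Z t a - E.theta a)
      rwa [sub_sub_cancel] at this
    linarith [hs.norm]
  have hθ'0 : 0 < θ' := by linarith
  have hb : L * C a / (θ' * gammaHat A Z t a) = L * C a * (G / θ') := by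
    simp only [G]
    field_simp
  have hG0 : 0 < G := lt_of_lt_of_le (by positivity) hsup.1
  have hb1 : 9 / 11 * q ≤ L * C a / (θ' * gammaHat A Z t a) := by
    rw [hb]
    have : 9 / 11 * q = L * C a * (9 / 10 * (1 / g) / (11 / 10 * θ)) := by
      rw [hq]
      field_simp
    rw [this]
    have := hsup.1
    gcongr
  have hb2 : L * C a / (θ' * gammaHat A Z t a) ≤ 11 / 9 * q := by
    rw [hb]
    have : 11 / 9 * q = L * C a * (11 / 10 * (1 / g) / (9 / 10 * θ)) := by
      rw [hq]
      field_simp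
    rw [this]
    have := hsup.2
    gcongr
  have hmu' : |muHat E.value A Z t a - E.mean a| ≤ 24 / 5 * (q * R) := by
    have e1 : C a / θ * (1 / g) * R ≤ q * R := mul_le_mul_of_nonneg_right hqC hR0
    have e2 : 1 / g * R ≤ q * R := mul_le_mul_of_nonneg_right hqg hR0
    have e3 : 6 / 5 * (C a / θ) * (1 / g * (3 / 2 * R)) + 2 / g * (3 / 2 * R) =
        9 / 5 * (C a / θ * (1 / g) * R) + 3 * (1 / g * R) := by ring
    linarith
  have hK : K / gammaHat A Z t a = K * G := by simp only [G]; ring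
  have hqS : q ≤ E.complexity C a := le_max_left _ _
  set p := ∑ y, E.probY a y * E.obsProb a y with hp
  have hpg : g ≤ p := E.gammaMin_le_sum a
  have hp0 : 0 < p := by linarith
  have huS : K / (g * Real.sqrt p) ≤ E.complexity C a := le_max_right _ _
  -- at least half of the expected number of observed outcomes are observed
  have hN0 : (0 : ℝ) < pulls A t a := Nat.cast_pos.2 hpulls
  have hobs' : p / 2 * pulls A t a ≤ obsPulls A Z t a := by
    rw [← le_div_iff₀ hN0]
    have h1 := (abs_le.1 hobs).1
    have h2 := hs.observed
    simp only [testWidth, one_mul] at h1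
    linarith
  have hsq : Real.sqrt (α * Real.log T / obsPulls A Z t a) ≤ Real.sqrt 2 / Real.sqrt p * R := by
    rw [hR, ← Real.sqrt_div zero_le_two, ← Real.sqrt_mul (by positivity)]
    refine Real.sqrt_le_sqrt ?_
    calc α * Real.log T / obsPulls A Z t a ≤ α * Real.log T / (p / 2 * pulls A t a) := by
          gcongr
      _ = 2 / p * (α * Real.log T / pulls A t a) := by
          field_simp
  have h2 : Real.sqrt 2 ≤ 3 / 2 := Real.sqrt_le_iff.2 ⟨by norm_num, by norm_num⟩
  have hsp : 0 < Real.sqrt p := Real.sqrt_pos.2 hp0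
  have hbonus : K / gammaHat A Z t a * Real.sqrt (α * Real.log T / obsPulls A Z t a) ≤
      33 / 20 * (E.complexity C a * R) := by
    rw [hK]
    calc K * G * Real.sqrt (α * Real.log T / obsPulls A Z t a)
        ≤ K * (11 / 10 * (1 / g)) * (3 / 2 / Real.sqrt p * R) := by
          have := hsup.2
          refine mul_le_mul (by gcongr) (hsq.trans (by gcongr)) (Real.sqrt_nonneg _)
            (by positivity)
      _ = 33 / 20 * (K / (g * Real.sqrt p) * R) := by
          field_simp
          ring
      _ ≤ _ := by gcongr
  have hbonus0 : 0 ≤ K / gammaHat A Z t a * Real.sqrt (α * Real.log T / obsPulls A Z t a) := by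
    rw [hK]
    positivity
  have hb1' : 9 / 11 * q * R ≤ L * C a / (θ' * gammaHat A Z t a) * R :=
    mul_le_mul_of_nonneg_right hb1 hR0
  have hb2' : L * C a / (θ' * gammaHat A Z t a) * R ≤ 11 / 9 * q * R :=
    mul_le_mul_of_nonneg_right hb2 hR0
  have hqR : 0 ≤ q * R := by positivity
  have hqSR : q * R ≤ E.complexity C a * R := mul_le_mul_of_nonneg_right hqS hR0
  have hu : ucb E.value C α T A Z t a = muHat E.value A Z t a +
      8 * (L * C a / (θ' * gammaHat A Z t a)) * R +
      K / gammaHat A Z t a * Real.sqrt (α * Real.log T / obsPulls A Z t a) := by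
    rw [hR]
    rfl
  have hm := abs_le.1 hmu'
  rw [hu]
  constructor
  · linarith [hm.1]
  · linarith [hm.2]

end Confidence

/-! ### Counting pulls -/

section Pulls

variable {n : ℕ}

theorem pulls_succ (A : ℕ → Fin n) (t : ℕ) (a : Fin n) :
    pulls A (t + 1) a = pulls A t a + if A t = a then 1 else 0 := by
  unfold pulls
  rw [range_add_one, filter_insert]
  split_ifs with h
  · rw [card_insert_of_notMem (by simp)]
  · rfl

theorem sum_pulls (A : ℕ → Fin n) (t : ℕ) : ∑ a, pulls A t a = t := by
  unfold pulls
  rw [← card_eq_sum_card_fiberwise fun _ _ => mem_univ _, card_range]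

theorem le_pulls_of_explore {A : ℕ → Fin n} {e t : ℕ}
    (h : ∀ s < n * e, (A s : ℕ) = s / e) (ht : n * e ≤ t) (a : Fin n) : e ≤ pulls A t a := by
  have hsub : Finset.Ico ((a : ℕ) * e) ((a + 1) * e) ⊆ {s ∈ range t | A s = a} := by
    intro s hs
    rw [mem_Ico] at hs
    have hle : ((a : ℕ) + 1) * e ≤ n * e := Nat.mul_le_mul_right _ a.2
    have hlt : s < n * e := hs.2.trans_le hle
    rw [mem_filter, mem_range]
    refine ⟨hlt.trans_le ht, Fin.ext ?_⟩
    rw [h s hlt]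
    exact Nat.div_eq_of_lt_le hs.1 hs.2
  have := card_le_card hsub
  rwa [Nat.card_Ico, ← Nat.sub_mul, Nat.add_sub_cancel_left, one_mul] at this

/-- Each arm `a` contributes `∑ k, w a / √k` over its pulls, which is at most `3 * w a * √N`. The
first pull contributes nothing, because `1 / √0 = 0`. -/
theorem sum_div_sqrt_pulls_le (A : ℕ → Fin n) {w : Fin n → ℝ} (hw : ∀ a, 0 ≤ w a) (t : ℕ) :
    ∑ s ∈ range t, w (A s) / Real.sqrt (pulls A s (A s)) ≤
      3 * ∑ a, w a * Real.sqrt (pulls A t a) := by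
  induction t with
  | zero => simp [pulls]
  | succ t ih =>
    rw [sum_range_succ]
    have hstep : ∑ a, w a * Real.sqrt (pulls A (t + 1) a) =
        ∑ a, w a * Real.sqrt (pulls A t a) +
          w (A t) * (Real.sqrt (pulls A t (A t) + 1) - Real.sqrt (pulls A t (A t))) := by
      rw [← sub_eq_iff_eq_add', ← sum_sub_distrib, sum_eq_single (A t)]
      · rw [pulls_succ, if_pos rfl]
        push_cast
        ring
      · intro a _ ha
        rw [pulls_succ, if_neg (Ne.symm ha), add_zero, sub_self]
      · simp
    rw [hstep, mul_add]
    refine add_le_add ih ?_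
    have key : ∀ N : ℕ, 1 / Real.sqrt N ≤ 3 * (Real.sqrt (N + 1) - Real.sqrt N) := by
      intro N
      rcases Nat.eq_zero_or_pos N with rfl | hN
      · simp
      · have hN' : (1 : ℝ) ≤ N := by exact_mod_cast hN
        have hs : 0 < Real.sqrt N := Real.sqrt_pos.2 (by linarith)
        have h1 : Real.sqrt N ^ 2 = N := Real.sq_sqrt (by linarith)
        have h2 : Real.sqrt (N + 1) ^ 2 = N + 1 := Real.sq_sqrt (by linarith)
        have h3 : Real.sqrt N ≤ Real.sqrt (N + 1) := Real.sqrt_le_sqrt (by linarith)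
        have h4 : Real.sqrt (N + 1) ≤ 2 * Real.sqrt N :=
          Real.sqrt_le_iff.2 ⟨by positivity, by nlinarith⟩
        rw [div_le_iff₀ hs]
        nlinarith
    have := mul_le_mul_of_nonneg_left (key (pulls A t (A t))) (hw (A t))
    rw [mul_one_div] at this
    linarith

theorem sum_div_sqrt_pulls_le_sqrt (A : ℕ → Fin n) {w : Fin n → ℝ} (hw : ∀ a, 0 ≤ w a) (t : ℕ) :
    ∑ s ∈ range t, w (A s) / Real.sqrt (pulls A s (A s)) ≤
      3 * (Real.sqrt (∑ a, w a ^ 2) * Real.sqrt t) := by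
  refine (sum_div_sqrt_pulls_le A hw t).trans (mul_le_mul_of_nonneg_left ?_ (by norm_num))
  refine (Real.sum_mul_le_sqrt_mul_sqrt _ _ _).trans (le_of_eq ?_)
  congr 2
  rw [sum_congr rfl fun a _ => Real.sq_sqrt (Nat.cast_nonneg _), ← Nat.cast_sum, sum_pulls]

end Pulls

/-! ### The regret -/

section Regret

variable {n K L T : ℕ} {E : Env n K L} {C : Fin n → ℝ} {α : ℝ}

theorem IsSmallRadius.mono {c θ γ r r' : ℝ} (h : IsSmallRadius K L c θ γ r) (hc : 0 ≤ c / θ)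
    (h0 : 0 ≤ r') (hr : r' ≤ r) : IsSmallRadius K L c θ γ r' where
  nonneg := h0
  pinv := le_trans (by gcongr) h.pinv
  norm := le_trans (by gcongr) h.norm
  weight := le_trans (by gcongr) h.weight
  observed := hr.trans h.observed

open Filter Topology in
theorem eventually_isSmallRadius {c θ γ : ℝ} (hθ : 0 < θ) (hγ : 0 < γ) {r : ℕ → ℝ}
    (hr : Tendsto r atTop (𝓝 0)) (h0 : ∀ T, 0 ≤ r T) :
    ∀ᶠ T in atTop, IsSmallRadius K L c θ γ (r T) := by
  have key : ∀ k b : ℝ, 0 < b → ∀ᶠ T in atTop, k * r T ≤ b := fun k b hb => by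
    have := hr.const_mul k
    rw [mul_zero] at this
    exact this.eventually_le_const hb
  filter_upwards [key ((K * K + 1) * (c / θ * L)) (1 / 20) (by norm_num),
    key L (θ / 10) (by positivity), key (6 / 5 * (c / θ)) (1 / 10) (by norm_num),
    key 1 (γ / 2) (by positivity)] with T h1 h2 h3 h4
  exact ⟨h0 T, by linarith, h2, h3, by linarith⟩

theorem Env.mean_le_bestMean (E : Env n K L) (a : Fin n) : E.mean a ≤ E.bestMean :=
  le_ciSup (f := E.mean) (Set.finite_range _).bddAbove a

theorem Env.IsNormalized.gap_le_two (hN : E.IsNormalized) (a : Fin n) :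
    E.bestMean - E.mean a ≤ 2 := by
  have : Nonempty (Fin n) := ⟨a⟩
  have h1 : E.bestMean ≤ 1 := ciSup_le fun b => (abs_le.1 (hN.abs_mean_le_one b)).2
  linarith [(abs_le.1 (hN.abs_mean_le_one a)).1]

/-- Dividing a deviation bound for a sum by the number `N` of pulls turns it into an accuracy
statement with radius `3 / 2 * √(α log T / N)`, because `√(2 α) ≤ 3 / 2 * √α`. -/
theorem isAccurate_of_deviation {A : ℕ → Fin n} {X : ℕ → Fin K × Fin L × Bool} {t : ℕ} {a : Fin n}
    (hE : E.IsComplete) (hα : 1 ≤ α) (hpulls : 0 < pulls A t a)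
    (hdev : ∀ i, |armSum A X t a (testFun E a i) - pulls A t a * E.expect a (testFun E a i)| ≤
      testWidth E a i * Real.sqrt (2 * pulls A t a * Real.log T))
    (hpos : ∀ s < t, E.law (A s) (X s) ≠ 0) :
    IsAccurate E A X t a (3 / 2 * Real.sqrt (α * Real.log T / pulls A t a)) := by
  refine ⟨fun i => ?_, hpos⟩
  have hN : (0 : ℝ) < pulls A t a := Nat.cast_pos.2 hpulls
  have hw := hE.testWidth_pos a i
  have e : armSum A X t a (testFun E a i) / pulls A t a - E.expect a (testFun E a i) =
      (armSum A X t a (testFun E a i) - pulls A t a * E.expect a (testFun E a i)) /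
        pulls A t a := by
    field_simp
  rw [e, abs_div, abs_of_pos hN, div_le_iff₀ hN]
  refine (hdev i).trans ?_
  rw [mul_assoc (testWidth E a i)]
  refine mul_le_mul_of_nonneg_left ?_ hw.le
  refine Real.sqrt_le_iff.2 ⟨by positivity, ?_⟩
  have hq : Real.sqrt (α * Real.log T / pulls A t a) ^ 2 = α * Real.log T / pulls A t a :=
    Real.sq_sqrt (by positivity)
  calc 2 * pulls A t a * Real.log T ≤ 9 / 4 * (α * (pulls A t a * Real.log T)) := by
        have h1 : 0 ≤ pulls A t a * Real.log T := by positivity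
        nlinarith
    _ = (3 / 2 * Real.sqrt (α * Real.log T / pulls A t a) * pulls A t a) ^ 2 := by
        rw [mul_pow, mul_pow, hq]
        field_simp
        ring

/-- The regret of a trajectory on which all sample means concentrate. -/
theorem IsRun.regret_le {Ω : Type*} [MeasurableSpace Ω] {P : Measure Ω} {A : ℕ → Ω → Fin n}
    {X : ℕ → Ω → Fin K × Fin L × Bool} (h : IsRun E C α T P A X) (hN : E.IsNormalized)
    (hM : E.IsMNAR) (hE : E.IsComplete) (hC : ∀ a, condNumber (E.theta a) ≤ C a) (hα : 1 ≤ α)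
    (hT : 1 ≤ Real.log T)
    (hs : ∀ a, IsSmallRadius K L (C a) (infNorm (E.theta a)) (E.gammaMin a)
      (3 / 2 * Real.sqrt (α / Real.log T)))
    {ω : Ω}
    (hdev : ∀ a i, ∀ t ≤ T, |armSum (fun s => A s ω) (fun s => X s ω) t a (testFun E a i) -
      pulls (fun s => A s ω) t a * E.expect a (testFun E a i)| ≤
      testWidth E a i * Real.sqrt (2 * pulls (fun s => A s ω) t a * Real.log T))
    (hpos : ∀ s < T, E.law (A s ω) (X s ω) ≠ 0) :
    regret E T A ω ≤ 2 * (n * exploreRounds T) +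
      51 * Real.sqrt (α * T * Real.log T * ∑ a, E.complexity C a ^ 2) := by
  set A' : ℕ → Fin n := fun s => A s ω
  set X' : ℕ → Fin K × Fin L × Bool := fun s => X s ω
  have hS0 : ∀ a, 0 ≤ E.complexity C a := fun a => zero_le_one.trans (hE.one_le_complexity C a)
  have he : 0 < exploreRounds T := Nat.ceil_pos.2 (by positivity)
  have hround : ∀ t ∈ range T, E.bestMean - E.mean (A' t) ≤
      (if t < n * exploreRounds T then 2 else 0) + 17 * Real.sqrt (α * Real.log T) *
        (E.complexity C (A' t) / Real.sqrt (pulls A' t (A' t))) := by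
    intro t ht
    rw [mem_range] at ht
    split_ifs with hlt
    · have := hS0 (A' t)
      have h1 := hN.gap_le_two (A' t)
      have h2 : 0 ≤ 17 * Real.sqrt (α * Real.log T) *
        (E.complexity C (A' t) / Real.sqrt (pulls A' t (A' t))) := by positivity
      linarith
    · rw [not_lt] at hlt
      have hexp : ∀ a, exploreRounds T ≤ pulls A' t a := le_pulls_of_explore
        (fun s hs => h.explore s ((hs.trans_le hlt).trans ht) hs ω) hlt
      have hbounds : ∀ a, E.mean a ≤ ucb E.value C α T A' (fun s => feedback (X' s)) t a ∧
          ucb E.value C α T A' (fun s => feedback (X' s)) t a - E.mean a ≤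
            17 * (E.complexity C a * Real.sqrt (α * Real.log T / pulls A' t a)) := by
        intro a
        have hp : 0 < pulls A' t a := he.trans_le (hexp a)
        have hpl : Real.log T ^ 2 ≤ pulls A' t a :=
          (Nat.le_ceil _).trans (Nat.cast_le.2 (hexp a))
        have hacc := isAccurate_of_deviation hE hα hp (fun i => hdev a i t ht.le)
          fun s hs => hpos s (hs.trans ht)
        have hθ := hE.infNorm_theta_pos a
        refine hacc.ucb_bounds hN hM hE (hC a) ((hs a).mono ?_ (by positivity) ?_) rfl hp
          (by positivity)
        · have := (one_le_condNumber hθ).trans (hC a)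
          positivity
        · refine mul_le_mul_of_nonneg_left (Real.sqrt_le_sqrt ?_) (by norm_num)
          calc α * Real.log T / pulls A' t a ≤ α * Real.log T / Real.log T ^ 2 := by gcongr
            _ = α / Real.log T := by field_simp
      have : Nonempty (Fin n) := ⟨A' t⟩
      obtain ⟨b, hb⟩ := exists_eq_ciSup_of_finite (f := E.mean)
      have hb' : E.mean b = E.bestMean := hb
      have hg := h.greedy t ht hlt ω b
      have h1 := (hbounds b).1
      have h2 := (hbounds (A' t)).2
      rw [Real.sqrt_div' _ (Nat.cast_nonneg _)] at h2
      rw [zero_add, ← hb']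
      calc E.mean b - E.mean (A' t) ≤ 17 * (E.complexity C (A' t) *
            (Real.sqrt (α * Real.log T) / Real.sqrt (pulls A' t (A' t)))) := by linarith
        _ = _ := by ring
  have hsum : ∑ t ∈ range T, (if t < n * exploreRounds T then (2 : ℝ) else 0) ≤
      2 * (n * exploreRounds T) := by
    rw [← sum_filter, sum_const, nsmul_eq_mul, mul_comm]
    refine mul_le_mul_of_nonneg_left ?_ zero_le_two
    have : #{t ∈ range T | t < n * exploreRounds T} ≤ n * exploreRounds T := by
      refine (card_le_card fun t ht => ?_).trans (card_range _).le
      exact mem_range.2 (mem_filter.1 ht).2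
    exact_mod_cast this
  have hmain := sum_div_sqrt_pulls_le_sqrt A' hS0 T
  have hsqrt : Real.sqrt (α * T * Real.log T * ∑ a, E.complexity C a ^ 2) =
      Real.sqrt (α * Real.log T) * (Real.sqrt (∑ a, E.complexity C a ^ 2) * Real.sqrt T) := by
    rw [← Real.sqrt_mul (sum_nonneg fun a _ => sq_nonneg _), ← Real.sqrt_mul (by positivity)]
    congr 1
    ring
  calc regret E T A ω ≤ ∑ t ∈ range T, ((if t < n * exploreRounds T then 2 else 0) +
        17 * Real.sqrt (α * Real.log T) *
        (E.complexity C (A' t) / Real.sqrt (pulls A' t (A' t)))) := sum_le_sum hround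
    _ ≤ 2 * (n * exploreRounds T) + 17 * Real.sqrt (α * Real.log T) *
        (3 * (Real.sqrt (∑ a, E.complexity C a ^ 2) * Real.sqrt T)) := by
        rw [sum_add_distrib, ← mul_sum]
        gcongr
    _ = _ := by
        rw [hsqrt]
        ring

open Filter Topology in
/-- For large horizons, the radius of the sample means after the exploration is small, and the
exploration contributes at most `√T` to the regret, and the failure of one of `k` sample means to
concentrate at most a constant. -/
theorem exists_threshold (n K L : ℕ) (C θ γ : Fin n → ℝ) (α : ℝ) (k : ℕ) :
    ∃ T₀ : ℕ, ∀ T : ℕ, T₀ ≤ T → 1 ≤ T ∧ 1 ≤ Real.log T ∧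
      2 * (n * (exploreRounds T : ℝ)) ≤ Real.sqrt T ∧ 8 * (k : ℝ) ≤ T ∧
      ∀ a, 0 < θ a → 0 < γ a →
        IsSmallRadius K L (C a) (θ a) (γ a) (3 / 2 * Real.sqrt (α / Real.log T)) := by
  have hcast : Tendsto (fun T : ℕ => (T : ℝ)) atTop atTop := tendsto_natCast_atTop_atTop
  have hlog : Tendsto (fun T : ℕ => Real.log T) atTop atTop := Real.tendsto_log_atTop.comp hcast
  have hrad : Tendsto (fun T : ℕ => 3 / 2 * Real.sqrt (α / Real.log T)) atTop (𝓝 0) := by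
    have h1 : Tendsto (fun T : ℕ => α / Real.log T) atTop (𝓝 0) := hlog.const_div_atTop α
    have h2 := (Real.continuous_sqrt.tendsto 0).comp h1
    rw [Real.sqrt_zero] at h2
    simpa using h2.const_mul (3 / 2)
  have hsq : ∀ᶠ T : ℕ in atTop, 4 * n * Real.log T ^ 2 ≤ Real.sqrt T := by
    have h1 := (isLittleO_log_rpow_rpow_atTop (s := 1 / 2) 2 (by norm_num)).comp_tendsto hcast
    have h2 := h1.def (c := 1 / (4 * n + 1)) (by positivity)
    filter_upwards [h2] with T hT
    simp only [Function.comp_apply, ← Real.sqrt_eq_rpow, Real.rpow_two, Real.norm_eq_abs,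
      abs_pow, sq_abs, abs_of_nonneg (Real.sqrt_nonneg _)] at hT
    rw [div_mul_eq_mul_div, one_mul, le_div_iff₀ (by positivity)] at hT
    nlinarith [sq_nonneg (Real.log T)]
  have hsmall : ∀ᶠ T : ℕ in atTop, ∀ a, 0 < θ a → 0 < γ a →
      IsSmallRadius K L (C a) (θ a) (γ a) (3 / 2 * Real.sqrt (α / Real.log T)) := by
    refine eventually_all.2 fun a => ?_
    by_cases h : 0 < θ a ∧ 0 < γ a
    · filter_upwards [eventually_isSmallRadius h.1 h.2 hrad fun T => by positivity] with T hT _ _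
      exact hT
    · exact Eventually.of_forall fun T h1 h2 => absurd ⟨h1, h2⟩ h
  have hall := (eventually_ge_atTop 1).and ((hlog.eventually_ge_atTop 1).and
    (hsq.and ((hcast.eventually_ge_atTop (8 * (k : ℝ))).and hsmall)))
  obtain ⟨T₀, hT₀⟩ := eventually_atTop.1 hall
  refine ⟨T₀, fun T hT => ?_⟩
  obtain ⟨h1, h2, h3, h4, h5⟩ := hT₀ T hT
  refine ⟨h1, h2, ?_, h4, h5⟩
  have hc : (exploreRounds T : ℝ) ≤ 2 * Real.log T ^ 2 := by
    have := (Nat.ceil_lt_add_one (sq_nonneg (Real.log T))).le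
    unfold exploreRounds
    nlinarith
  refine le_trans ?_ h3
  have : (0 : ℝ) ≤ n := Nat.cast_nonneg _
  nlinarith

end Regret

end MNARBandit

/-- The constant `c` is universal, and the threshold `T₀` depends on the environment only through
the numbers of arms, mediator values and outcomes, the bounds `C a` on the condition numbers, the
norms of the matrices `Θ_a` and the numbers `γ_a`. -/
theorem mainTheorem7 :
    ∃ c : ℝ, 0 < c ∧
      ∀ (n K L : ℕ) (C θ γ : Fin n → ℝ) (α : ℝ), 1 < α →
        ∃ T₀ : ℕ, ∀ E : MNARBandit.Env n K L,
          E.IsNormalized → E.IsMNAR → E.IsComplete →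
          (∀ a, MNARBandit.condNumber (E.theta a) ≤ C a) →
          (∀ a, MNARBandit.infNorm (E.theta a) = θ a) →
          (∀ a, E.gammaMin a = γ a) →
          ∀ T : ℕ, T₀ ≤ T →
            ∀ {Ω : Type*} [MeasurableSpace Ω] (P : MeasureTheory.Measure Ω)
              [MeasureTheory.IsProbabilityMeasure P]
              (A : ℕ → Ω → Fin n) (X : ℕ → Ω → Fin K × Fin L × Bool),
              MNARBandit.IsRun E C α T P A X →
                ∫ ω, MNARBandit.regret E T A ω ∂P ≤
                  c * Real.sqrt (α * T * Real.log T * ∑ a, E.complexity C a ^ 2) := by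
  refine ⟨53, by norm_num, fun n K L C θ γ α hα => ?_⟩
  obtain ⟨T₀, hT₀⟩ := MNARBandit.exists_threshold n K L C θ γ α
    (n * Fintype.card ((Fin K × Fin L) ⊕ Fin K ⊕ Bool))
  refine ⟨T₀, ?_⟩
  intro E hN hM hE hC hθ hγ T hT Ω _ P _ A X h
  obtain ⟨hT1, hlog, hexp, hfail, hsmall⟩ := hT₀ T hT
  have hT1' : (1 : ℝ) ≤ T := by exact_mod_cast hT1
  have hs : ∀ a, MNARBandit.IsSmallRadius K L (C a) (MNARBandit.infNorm (E.theta a))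
      (E.gammaMin a) (3 / 2 * Real.sqrt (α / Real.log T)) := fun a => by
    rw [hθ, hγ]
    exact hsmall a (hθ a ▸ hE.infNorm_theta_pos a) (hγ a ▸ hE.gammaMin_pos a)
  obtain ⟨ω₀⟩ : Nonempty Ω := MeasureTheory.nonempty_of_isProbabilityMeasure P
  set Q := Real.sqrt (α * T * Real.log T * ∑ a, E.complexity C a ^ 2) with hQ
  have hQT : Real.sqrt T ≤ Q := by
    refine Real.sqrt_le_sqrt ?_
    have h1 : 1 ≤ ∑ a, E.complexity C a ^ 2 := by
      refine le_trans ?_ (single_le_sum (f := fun a => E.complexity C a ^ 2)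
        (fun a _ => sq_nonneg _) (mem_univ (A 0 ω₀)))
      exact one_le_pow₀ (hE.one_le_complexity C _)
    have h2 : 1 ≤ α * Real.log T * ∑ a, E.complexity C a ^ 2 :=
      one_le_mul_of_one_le_of_one_le (one_le_mul_of_one_le_of_one_le hα.le hlog) h1
    nlinarith
  set bad : Set Ω := {ω | ∃ a i, ∃ t ≤ T, MNARBandit.testWidth E a i *
    Real.sqrt (2 * MNARBandit.pulls (fun s => A s ω) t a * Real.log T) <
      |MNARBandit.armSum (fun s => A s ω) (fun s => X s ω) t a (MNARBandit.testFun E a i) -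
        MNARBandit.pulls (fun s => A s ω) t a * E.expect a (MNARBandit.testFun E a i)|} with hbad
  have hPbad := h.measure_exists_deviation_le (MNARBandit.testFun E) (MNARBandit.testLow E)
    (MNARBandit.testWidth E) hE.testWidth_pos (hE.testFun_mem_Icc hN) hT1
  rw [← hbad, ← measure_toMeasurable] at hPbad
  set bad' := toMeasurable P bad
  have hbad' : MeasurableSet bad' := measurableSet_toMeasurable P bad
  have hreal : P.real bad' ≤
      4 * (n * Fintype.card ((Fin K × Fin L) ⊕ Fin K ⊕ Bool)) / (T : ℝ) ^ 2 :=
    ENNReal.toReal_le_of_le_ofReal (by positivity) hPbad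
  have hreg0 : ∀ ω, 0 ≤ MNARBandit.regret E T A ω := fun ω =>
    sum_nonneg fun t _ => sub_nonneg.2 (E.mean_le_bestMean _)
  have hreg2 : ∀ ω, MNARBandit.regret E T A ω ≤ 2 * T := fun ω => by
    refine (sum_le_sum fun t _ => hN.gap_le_two (A t ω)).trans (le_of_eq ?_)
    rw [sum_const, card_range, nsmul_eq_mul, mul_comm]
  have hae : ∀ᵐ ω ∂P, MNARBandit.regret E T A ω ≤
      (Real.sqrt T + 51 * Q) + bad'.indicator (fun _ => 2 * (T : ℝ)) ω := by
    filter_upwards [h.ae_law_ne_zero] with ω hω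
    by_cases hb : ω ∈ bad'
    · rw [Set.indicator_of_mem hb]
      have := hreg2 ω
      have : 0 ≤ Real.sqrt T + 51 * Q := by positivity
      linarith
    · rw [Set.indicator_of_notMem hb, add_zero]
      have hnot : ω ∉ bad := fun hm => hb (subset_toMeasurable P bad hm)
      have := h.regret_le hN hM hE hC hα.le hlog hs (ω := ω) (fun a i t ht => by
        by_contra! hlt
        exact hnot ⟨a, i, t, ht, hlt⟩) hω
      linarith
  have hint : MeasureTheory.Integrable (bad'.indicator fun _ => 2 * (T : ℝ)) P :=
    (MeasureTheory.integrable_const _).indicator hbad'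
  have hfail' : P.real bad' * (2 * T) ≤ 1 := by
    calc P.real bad' * (2 * T) ≤
        4 * (n * Fintype.card ((Fin K × Fin L) ⊕ Fin K ⊕ Bool)) / (T : ℝ) ^ 2 * (2 * T) := by
          gcongr
      _ = 8 * ((n * Fintype.card ((Fin K × Fin L) ⊕ Fin K ⊕ Bool) : ℕ) : ℝ) / T := by
          push_cast
          field_simp
          ring
      _ ≤ 1 := by
          rw [div_le_one (by linarith)]
          exact hfail
  have hsqrtT : 1 ≤ Real.sqrt T := Real.one_le_sqrt.2 hT1'
  calc ∫ ω, MNARBandit.regret E T A ω ∂P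
      ≤ ∫ ω, ((Real.sqrt T + 51 * Q) + bad'.indicator (fun _ => 2 * (T : ℝ)) ω) ∂P :=
        MeasureTheory.integral_mono_of_nonneg (Filter.Eventually.of_forall hreg0)
          ((MeasureTheory.integrable_const _).add hint) hae
    _ = (Real.sqrt T + 51 * Q) + P.real bad' * (2 * T) := by
        rw [MeasureTheory.integral_add (MeasureTheory.integrable_const _) hint,
          MeasureTheory.integral_indicator_const _ hbad']
        simp
    _ ≤ 53 * Q := by linarith
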